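/- Let $d,\sigma\ge 1$ be integers, $\mu\in\{1,-1\}$, $\mathbb T=\mathbb R/2\pi\mathbb Z$, and consider the nonlinear Schrödinger equation $$ i\partial_t\psi+\tfrac12\Delta\psi=\mu|\psi|^{2\sigma}\psi,\qquad x\in\mathbb T^d, \tag{1}$$ and the renormalized cubic equation $$ i\partial_t\psi+\tfrac12\Delta\psi=\mu|\psi|^{2}\psi-\frac{2\mu}{(2\pi)^d}\Big(\int_{\mathbb T^d}|\psi(t,x)|^2\,dx\Big)\psi,\qquad x\in\mathbb T^d. \tag{2}$$ For $s\in\mathbb R$ and $p\in[1,\infty]$ let $\mathcal FL^{s,p}(\mathbb T^d)$ be the space of distributions $f\in\mathcal D'(\mathbb T^d,\mathbb C)$ with $\langle\cdot\rangle^s\hat f\in\ell^p(\mathbb Z^d)$, normed by $\|f\|_{\mathcal FL^{s,p}}=\|\langle\cdot\rangle^s\hat f\|_{\ell^p}$, where $\langle k\rangle=(1+|k|^2)^{1/2}$ and $\hat f(k)=(2\pi)^{-d}\langle f,e^{-ik\cdot x}\rangle$; in particular $H^s=\mathcal FL^{s,2}$. A smooth solution is a function $\psi\in C^\infty(J\times\mathbb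 T^d,\mathbb C)$ that solves the equation on $J\times\mathbb T^d$, where $J\ni 0$ is an open interval; for $T>0$, $\|\psi\|_{L^\infty(0,T;X)}$ denotes the essential supremum of $\|\psi(t)\|_X$ over $t\in(0,T)\cap J$ (that is, over the times in $(0,T)$ at which $\psi$ is defined). Let $p_1,p_2\in[1,\infty]$, $T>0$ and $s\in\mathbb R$, and assume * in the case of (1): either $d\sigma\ge2$ and $s<0$, or $d=\sigma=1$ and $s<-2/3$; * in the case of (2): either $d\ge2$ and $s<0$, or $d=1$ and $s<-2/3$. Then for no $r\in\mathbb R$ do there exist a neighborhood $U$ of $0$ in $\mathcal FL^{s,p_1}(\mathbb T^d)$ and a continuous function $M_r:\mathbb R_{\ge0}\to\mathbb R_{\ge0}$ such that every smooth solution $\psi$ of (1) (respectively of (2)) with $\psi(0)\in U$ satisfies $$\|\psi\|_{L^\infty(0,T;\mathcal FL^{r,p_2}(\mathbb T^d))}\le M_r\big(\|\psi(0)\|_{\mathcal FL^{s,p_1}(\mathbb T^d)}\big).$$ In particular, for no $r\in\mathbb R$ is there a continuous function $M_r:\mathbb R_{\ge0}\to\mathbb R_{\ge0}$ such that every smooth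 solution $\psi$ of (1) (respectively of (2)) satisfies $\|\psi\|_{L^\infty(0,T;H^r(\mathbb T^d))}\le M_r(\|\psi(0)\|_{H^s(\mathbb T^d)})$. -/

import Mathlib

open scoped ENNReal NNReal Topology ContDiff

noncomputable section

namespace PeriodicNLS

/-- `C^∞(𝕋^d, ℂ)` for `𝕋 = ℝ / 2πℤ`: the smooth functions on `ℝ^d` that are `2π`-periodic in every
variable. -/
def SmoothTorus (d : ℕ) : Submodule ℂ ((Fin d → ℝ) → ℂ) where
  carrier := {f | ContDiff ℝ ∞ f ∧ ∀ x i, f (x + Pi.single i (2 * Real.pi)) = f x}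
  add_mem' := fun {f g} hf hg =>
    ⟨hf.1.add hg.1, fun x i => by simp only [Pi.add_apply, hf.2 x i, hg.2 x i]⟩
  zero_mem' := ⟨contDiff_const, fun _ _ => rfl⟩
  smul_mem' := fun c f hf =>
    ⟨contDiff_const.smul hf.1, fun x i => by simp only [Pi.smul_apply, hf.2 x i]⟩

instance (d : ℕ) : CoeFun (SmoothTorus d) (fun _ => (Fin d → ℝ) → ℂ) := ⟨fun f => f.1⟩

/-- The fundamental cell `[0, 2π]^d`; integrals over `𝕋^d` are integrals over it. -/
def cell (d : ℕ) : Set (Fin d → ℝ) := Set.Icc 0 (fun _ => 2 * Real.pi)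

/-- `𝒟'(𝕋^d, ℂ)`: the linear functionals on `C^∞(𝕋^d)` that are continuous, that is, bounded by a
constant times the largest of the sup norms of the derivatives up to some order `N`. -/
def TorusDistribution (d : ℕ) : Submodule ℂ (SmoothTorus d →ₗ[ℂ] ℂ) where
  carrier := {u | ∃ (N : ℕ) (C : ℝ), ∀ (φ : SmoothTorus d) (B : ℝ),
    (∀ n ≤ N, ∀ x, ‖iteratedFDeriv ℝ n φ.1 x‖ ≤ B) → ‖u φ‖ ≤ C * B}
  add_mem' := by
    rintro u v ⟨N, C, hu⟩ ⟨N', C', hv⟩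
    refine ⟨max N N', C + C', fun φ B hB => ?_⟩
    have h1 := hu φ B fun n hn => hB n (hn.trans (le_max_left _ _))
    have h2 := hv φ B fun n hn => hB n (hn.trans (le_max_right _ _))
    calc ‖(u + v) φ‖ ≤ ‖u φ‖ + ‖v φ‖ := norm_add_le _ _
      _ ≤ (C + C') * B := by linarith
  zero_mem' := ⟨0, 0, fun φ B _ => by simp⟩
  smul_mem' := by
    rintro c u ⟨N, C, hu⟩
    refine ⟨N, ‖c‖ * C, fun φ B hB => ?_⟩
    rw [LinearMap.smul_apply, norm_smul, mul_assoc]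
    exact mul_le_mul_of_nonneg_left (hu φ B hB) (norm_nonneg c)

theorem integrableOn_cell {d : ℕ} {f : (Fin d → ℝ) → ℂ} (hf : Continuous f) :
    MeasureTheory.IntegrableOn f (cell d) :=
  hf.continuousOn.integrableOn_compact isCompact_Icc

/-- A smooth function as a distribution, `φ ↦ ∫_{𝕋^d} f φ`. -/
def toDistribution {d : ℕ} (f : SmoothTorus d) : TorusDistribution d :=
  ⟨{ toFun := fun φ => ∫ x in cell d, f x * φ x
     map_add' := fun φ χ => by
       have h := MeasureTheory.integral_add
         (integrableOn_cell (f.2.1.continuous.mul φ.2.1.continuous))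
         (integrableOn_cell (f.2.1.continuous.mul χ.2.1.continuous))
       refine Eq.trans ?_ h
       congr 1
       funext x
       exact mul_add _ _ _
     map_smul' := fun c φ => by
       rw [RingHom.id_apply, smul_eq_mul, ← MeasureTheory.integral_const_mul]
       congr 1
       funext x
       exact mul_left_comm _ _ _ },
   by
    refine ⟨0, ∫ x in cell d, ‖f x‖, fun φ B hB => ?_⟩
    rw [← MeasureTheory.integral_mul_const]
    refine MeasureTheory.norm_integral_le_of_norm_le
      ((integrableOn_cell f.2.1.continuous).norm.mul_const B)
      (Filter.Eventually.of_forall fun x => ?_)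
    have h := hB 0 le_rfl x
    rw [norm_iteratedFDeriv_zero] at h
    rw [norm_mul]
    exact mul_le_mul_of_nonneg_left h (norm_nonneg _)⟩

/-- The character `x ↦ e^{i k · x}`. -/
def character {d : ℕ} (k : Fin d → ℤ) : SmoothTorus d :=
  ⟨fun x => Complex.exp (Complex.I * ((∑ j, (k j : ℝ) * x j : ℝ) : ℂ)), by
    refine ⟨?_, fun x i => ?_⟩
    · have h : ContDiff ℝ ∞ (fun x : Fin d → ℝ => ∑ j, (k j : ℝ) * x j) :=
        ContDiff.sum fun (j : Fin d) _ => contDiff_const.mul (contDiff_apply ℝ ℝ j)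
      exact (contDiff_const.mul (Complex.ofRealCLM.contDiff.comp h)).cexp
    · have h : (∑ j, (k j : ℝ) * (x + Pi.single i (2 * Real.pi) : Fin d → ℝ) j)
          = (∑ j, (k j : ℝ) * x j) + (k i : ℝ) * (2 * Real.pi) := by
        simp [mul_add, Finset.sum_add_distrib, Pi.single_apply]
      beta_reduce
      rw [h]
      refine Complex.exp_eq_exp_iff_exists_int.2 ⟨k i, ?_⟩
      push_cast
      ring⟩

/-- The Fourier coefficient `û(k) = (2π)^{-d} ⟨u, e^{-i k · x}⟩`. -/
def distFourierCoeff {d : ℕ} (u : TorusDistribution d) (k : Fin d → ℤ) : ℂ :=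
  ((2 * Real.pi : ℝ) ^ d : ℂ)⁻¹ * u.1 (character (-k))

/-- The weighted Fourier coefficients `⟨k⟩^s û(k)`, where `⟨k⟩ = (1 + |k|²)^{1/2}`. -/
def weightedCoeff {d : ℕ} (s : ℝ) (u : TorusDistribution d) (k : Fin d → ℤ) : ℂ :=
  ((Real.sqrt (1 + ∑ j, (k j : ℝ) ^ 2) ^ s : ℝ) : ℂ) * distFourierCoeff u k

theorem weightedCoeff_add {d : ℕ} (s : ℝ) (u v : TorusDistribution d) :
    weightedCoeff s (u + v) = weightedCoeff s u + weightedCoeff s v := by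
  funext k
  simp [weightedCoeff, distFourierCoeff, mul_add]

theorem weightedCoeff_smul {d : ℕ} (s : ℝ) (c : ℂ) (u : TorusDistribution d) :
    weightedCoeff s (c • u) = c • weightedCoeff s u := by
  funext k
  simp [weightedCoeff, distFourierCoeff, mul_left_comm]

/-- The Fourier-Lebesgue space `ℱL^{s,p}(𝕋^d)`: the distributions with `⟨·⟩^s û ∈ ℓ^p(ℤ^d)`. -/
def FL (d : ℕ) (s : ℝ) (p : ℝ≥0∞) : Submodule ℂ (TorusDistribution d) where
  carrier := {u | Memℓp (weightedCoeff s u) p}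
  add_mem' := fun {u v} hu hv => by
    have h := Memℓp.add hu hv
    rwa [← weightedCoeff_add] at h
  zero_mem' := by
    have h : weightedCoeff s (0 : TorusDistribution d) = 0 := by
      funext k
      simp [weightedCoeff, distFourierCoeff]
    change Memℓp (weightedCoeff s (0 : TorusDistribution d)) p
    rw [h]
    exact zero_memℓp
  smul_mem' := fun c u hu => by
    have h := Memℓp.const_smul hu c
    rwa [← weightedCoeff_smul] at h

/-- The map `u ↦ ⟨·⟩^s û` from `ℱL^{s,p}(𝕋^d)` to `ℓ^p(ℤ^d)`. -/
def FL.toLp (d : ℕ) (s : ℝ) (p : ℝ≥0∞) : FL d s p →ₗ[ℂ] lp (fun _ : Fin d → ℤ => ℂ) p where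
  toFun := fun u => ⟨weightedCoeff s u.1, u.2⟩
  map_add' := fun u v => Subtype.ext (weightedCoeff_add s u.1 v.1)
  map_smul' := fun c u => Subtype.ext (weightedCoeff_smul s c u.1)

/-- The norm `‖u‖_{ℱL^{s,p}} = ‖⟨·⟩^s û‖_{ℓ^p}`, and the topology that it defines. -/
instance FL.instSeminormedAddCommGroup (d : ℕ) (s : ℝ) (p : ℝ≥0∞) [Fact (1 ≤ p)] :
    SeminormedAddCommGroup (FL d s p) :=
  SeminormedAddCommGroup.induced (FL d s p) (lp (fun _ : Fin d → ℤ => ℂ) p) (FL.toLp d s p)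

/-- The Sobolev space `H^s(𝕋^d) = ℱL^{s,2}(𝕋^d)`. -/
abbrev Sobolev (d : ℕ) (s : ℝ) : Submodule ℂ (TorusDistribution d) := FL d s 2

/-- `‖u‖_{ℱL^{s,p}}` for an arbitrary distribution `u`, with the value `∞` if `u ∉ ℱL^{s,p}`. -/
def flENorm {d : ℕ} (s : ℝ) (p : ℝ≥0∞) [Fact (1 ≤ p)] (u : TorusDistribution d) : ℝ≥0∞ :=
  ⨅ h : u ∈ FL d s p, ‖(⟨u, h⟩ : FL d s p)‖ₑ

/-- `Δ = ∑ₖ ∂²/∂xₖ²`. -/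
def torusLaplacian {d : ℕ} (f : (Fin d → ℝ) → ℂ) (x : Fin d → ℝ) : ℂ :=
  ∑ k, iteratedDeriv 2 (fun y : ℝ => f (Function.update x k y)) (x k)

/-- The nonlinearity `μ |ψ|^{2σ} ψ`. -/
def nlsTerm {d : ℕ} (μ : ℝ) (σ : ℕ) (f : SmoothTorus d) (x : Fin d → ℝ) : ℂ :=
  (μ : ℂ) * ((‖f x‖ ^ (2 * σ) : ℝ) : ℂ) * f x

/-- The renormalized cubic nonlinearity `μ |ψ|² ψ - (2μ / (2π)^d) (∫_{𝕋^d} |ψ|²) ψ`. -/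
def renormalizedTerm {d : ℕ} (μ : ℝ) (f : SmoothTorus d) (x : Fin d → ℝ) : ℂ :=
  (μ : ℂ) * ((‖f x‖ ^ 2 : ℝ) : ℂ) * f x
    - ((2 * μ / (2 * Real.pi) ^ d * ∫ y in cell d, ‖f y‖ ^ 2 : ℝ) : ℂ) * f x

/-- `ψ` is a smooth solution of `i ∂ₜψ + ½ Δψ = F(ψ)` on `J × 𝕋^d`, where `J` is an open interval of
times with `0 ∈ J`. The values of `ψ` at times outside `J` play no role. -/
structure IsSmoothSolution {d : ℕ} (F : SmoothTorus d → (Fin d → ℝ) → ℂ) (J : Set ℝ)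
    (ψ : ℝ → SmoothTorus d) : Prop where
  isOpen : IsOpen J
  ordConnected : J.OrdConnected
  zero_mem : (0 : ℝ) ∈ J
  contDiffOn : ContDiffOn ℝ ∞ (fun q : ℝ × (Fin d → ℝ) => ψ q.1 q.2) (J ×ˢ Set.univ)
  equation : ∀ t ∈ J, ∀ x,
    Complex.I * deriv (fun τ => ψ τ x) t + (1 / 2 : ℂ) * torusLaplacian (ψ t) x = F (ψ t) x

/-- `‖ψ‖_{L^∞(0,T; ℱL^{r,p})}` for a function `ψ` with time interval `J`: the essential supremum
over the times in `(0,T)` at which `ψ` is defined. -/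
def timeSupNorm {d : ℕ} (r : ℝ) (p : ℝ≥0∞) [Fact (1 ≤ p)] (T : ℝ) (J : Set ℝ)
    (ψ : ℝ → SmoothTorus d) : ℝ≥0∞ :=
  essSup (fun t => flENorm r p (toDistribution (ψ t)))
    (MeasureTheory.volume.restrict (Set.Ioo 0 T ∩ J))

/-- The a priori estimate `‖ψ‖_{L^∞(0,T; ℱL^{r,p₂})} ≤ M(‖ψ(0)‖_{ℱL^{s,p₁}})` for all smooth solutions
of `i ∂ₜψ + ½ Δψ = F(ψ)` with `ψ(0) ∈ U`. -/
def AprioriEstimate {d : ℕ} (F : SmoothTorus d → (Fin d → ℝ) → ℂ) (s : ℝ) (p₁ : ℝ≥0∞)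
    [Fact (1 ≤ p₁)] (r : ℝ) (p₂ : ℝ≥0∞) [Fact (1 ≤ p₂)] (T : ℝ) (U : Set (FL d s p₁))
    (M : ℝ≥0 → ℝ≥0) : Prop :=
  ∀ (J : Set ℝ) (ψ : ℝ → SmoothTorus d), IsSmoothSolution F J ψ →
    ∀ u ∈ U, (u : TorusDistribution d) = toDistribution (ψ 0) →
      timeSupNorm r p₂ T J ψ ≤ (M ‖u‖₊ : ℝ≥0∞)

/-- The a priori estimate `‖ψ‖_{L^∞(0,T; H^r)} ≤ M(‖ψ(0)‖_{H^s})` for all smooth solutions of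
`i ∂ₜψ + ½ Δψ = F(ψ)`. -/
def SobolevAprioriEstimate {d : ℕ} (F : SmoothTorus d → (Fin d → ℝ) → ℂ) (s r T : ℝ)
    (M : ℝ≥0 → ℝ≥0) : Prop :=
  ∀ (J : Set ℝ) (ψ : ℝ → SmoothTorus d), IsSmoothSolution F J ψ →
    ∀ u : Sobolev d s, (u : TorusDistribution d) = toDistribution (ψ 0) →
      timeSupNorm r 2 T J ψ ≤ (M ‖u‖₊ : ℝ≥0∞)

end PeriodicNLS

end

open PeriodicNLS

/-
The equations are solved on the Fourier side, in `ℓ¹` of a graded monoid of modes: a power-like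
nonlinearity is a bounded multilinear operation there, and the free flow, which acts by unimodular
multipliers, is removed by passing to the interaction picture. Picard–Lindelöf then yields a
solution, and the first Picard iterate approximates it up to `O(t²)`. The nonlinearity commutes with
damping by the degree, so a damped copy of the solution with correspondingly enlarged data has
rapidly decaying coefficients and is smooth in `(t, x)`.

The data `A ∑ⱼ exp(i N kⱼ · x)` with `kⱼ ≠ 0` have norm `≲ N ^ s A` in `ℱL^{s,p}`. Interactions of
the `kⱼ` that sum to zero feed the zero mode, which every `ℱL^{r,p}` norm controls: at time `t` it
equals `A ^ (2σ+1)` times an integral of phases, up to `O(A ^ (4σ+1) t²)`. If one of these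
interactions is resonant, as is possible for `dσ ≥ 2`, its phase is constant; take `A` large,
`t = δ / A ^ (2σ)` and `N → ∞`. Otherwise the phases remain coherent up to `t = c / N²`; take
`A = N ^ a` with `2 / (2σ+1) < a < min (1/σ) (-s)`, which for `σ = 1` requires `s < -2/3`.
-/

namespace PeriodicNLS

noncomputable section

/-- The sequence space `ℓ¹(ι)`, in which the Fourier side of the equation is solved. -/
abbrev L1 (ι : Type*) : Type _ := ↥(lp (fun _ : ι => ℂ) 1)

section L1

variable {ι : Type*} {E : Type*} [NormedAddCommGroup E] [NormedSpace ℂ E]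

theorem L1.summable_norm (a : L1 ι) : Summable fun i => ‖a i‖ := by
  simpa using (lp.memℓp a).summable (by simp)

theorem L1.norm_eq (a : L1 ι) : ‖a‖ = ∑' i, ‖a i‖ := by
  simpa using lp.norm_eq_tsum_rpow (p := 1) (by simp) a

theorem L1.summable_smul (a : L1 ι) {f : ι → E} {C : ℝ} (hf : ∀ i, ‖f i‖ ≤ C) :
    Summable fun i => ‖a i • f i‖ := by
  refine Summable.of_nonneg_of_le (fun i => norm_nonneg _) (fun i => ?_)
    (a.summable_norm.mul_right C)
  rw [norm_smul]
  exact mul_le_mul_of_nonneg_left (hf i) (norm_nonneg _)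

theorem L1.norm_tsum_smul_le (a : L1 ι) {f : ι → E} {C : ℝ} (hf : ∀ i, ‖f i‖ ≤ C) :
    ‖∑' i, a i • f i‖ ≤ C * ‖a‖ := by
  have hle : ∀ i, ‖a i • f i‖ ≤ C * ‖a i‖ := fun i => by
    rw [norm_smul, mul_comm]
    exact mul_le_mul_of_nonneg_right (hf i) (norm_nonneg _)
  calc ‖∑' i, a i • f i‖ ≤ ∑' i, ‖a i • f i‖ := norm_tsum_le_tsum_norm (a.summable_smul hf)
    _ ≤ ∑' i, C * ‖a i‖ := (a.summable_smul hf).tsum_le_tsum hle (a.summable_norm.mul_left C)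
    _ = C * ‖a‖ := by rw [tsum_mul_left, L1.norm_eq]

section UnitVec

variable [DecidableEq ι]

/-- The unit vectors of `ℓ¹(ι)`. -/
def unitVec (i : ι) : L1 ι := lp.single 1 i 1

theorem unitVec_apply (i j : ι) : unitVec i j = if j = i then 1 else 0 := by
  rw [unitVec, lp.single_apply, Pi.single_apply]

@[simp] theorem norm_unitVec (i : ι) : ‖unitVec i‖ = 1 := by
  rw [unitVec, lp.norm_single one_pos, norm_one]

theorem L1.clm_ext {F G : L1 ι →L[ℂ] E} (h : ∀ i, F (unitVec i) = G (unitVec i)) : F = G :=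
  lp.ext_continuousLinearMap (by simp) fun i => by
    ext
    exact h i

end UnitVec

variable [CompleteSpace E]

open Classical in
/-- The continuous linear map `ℓ¹(ι) → E` sending the `i`-th unit vector to `f i`, for a bounded
family `f`; it is `0` if `f` is unbounded. -/
def l1Lift (f : ι → E) : L1 ι →L[ℂ] E :=
  if h : ∃ C, ∀ i, ‖f i‖ ≤ C then
    LinearMap.mkContinuous
      { toFun := fun a => ∑' i, a i • f i
        map_add' := fun a b => by
          obtain ⟨C, hC⟩ := h
          refine Eq.trans ?_
            ((a.summable_smul hC).of_norm.tsum_add (b.summable_smul hC).of_norm)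
          exact tsum_congr fun i => add_smul _ _ _
        map_smul' := fun c a => by
          obtain ⟨C, hC⟩ := h
          refine Eq.trans ?_ ((a.summable_smul hC).of_norm.tsum_const_smul c)
          exact tsum_congr fun i => mul_smul _ _ _ }
      h.choose (fun a => a.norm_tsum_smul_le h.choose_spec)
  else 0

variable {f : ι → E} {C : ℝ}

theorem l1Lift_apply (hf : ∀ i, ‖f i‖ ≤ C) (a : L1 ι) : l1Lift f a = ∑' i, a i • f i := by
  rw [l1Lift, dif_pos ⟨C, hf⟩]
  rfl

theorem norm_l1Lift_apply_le (hf : ∀ i, ‖f i‖ ≤ C) (a : L1 ι) : ‖l1Lift f a‖ ≤ C * ‖a‖ := by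
  rw [l1Lift_apply hf]
  exact a.norm_tsum_smul_le hf

theorem norm_l1Lift_le (hC : 0 ≤ C) (hf : ∀ i, ‖f i‖ ≤ C) : ‖l1Lift f‖ ≤ C :=
  ContinuousLinearMap.opNorm_le_bound _ hC (norm_l1Lift_apply_le hf)

variable [DecidableEq ι]

theorem l1Lift_unitVec (hf : ∀ i, ‖f i‖ ≤ C) (i : ι) : l1Lift f (unitVec i) = f i := by
  rw [l1Lift_apply hf, tsum_eq_single i fun j hj => by rw [unitVec_apply, if_neg hj, zero_smul],
    unitVec_apply, if_pos rfl, one_smul]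

/-- The multiplication operator `(aᵢ) ↦ (mᵢ aᵢ)` on `ℓ¹(ι)`, for a bounded family `m`. -/
def diag (m : ι → ℂ) : L1 ι →L[ℂ] L1 ι := l1Lift fun i => m i • unitVec i

variable {m m' : ι → ℂ} {C' : ℝ}

theorem norm_smul_unitVec_le (hm : ∀ i, ‖m i‖ ≤ C) (i : ι) : ‖m i • unitVec i‖ ≤ C := by
  rw [norm_smul, norm_unitVec, mul_one]
  exact hm i

theorem diag_unitVec (hm : ∀ i, ‖m i‖ ≤ C) (i : ι) : diag m (unitVec i) = m i • unitVec i :=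
  l1Lift_unitVec (norm_smul_unitVec_le hm) i

theorem norm_diag_le (hC : 0 ≤ C) (hm : ∀ i, ‖m i‖ ≤ C) : ‖diag m‖ ≤ C :=
  norm_l1Lift_le hC (norm_smul_unitVec_le hm)

theorem norm_diag_apply_le (hm : ∀ i, ‖m i‖ ≤ C) (a : L1 ι) : ‖diag m a‖ ≤ C * ‖a‖ :=
  norm_l1Lift_apply_le (norm_smul_unitVec_le hm) a

theorem diag_apply (hm : ∀ i, ‖m i‖ ≤ C) (a : L1 ι) (j : ι) : diag m a j = m j * a j := by
  have h : (lp.evalCLM ℂ (fun _ : ι => ℂ) 1 j).comp (diag m)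
      = m j • lp.evalCLM ℂ (fun _ : ι => ℂ) 1 j := by
    refine L1.clm_ext fun i => ?_
    rw [ContinuousLinearMap.comp_apply, diag_unitVec hm]
    change m i * unitVec i j = m j * unitVec i j
    rw [unitVec_apply]
    split_ifs with hij
    · rw [hij]
    · simp only [mul_zero]
  exact DFunLike.congr_fun h a

theorem diag_comp (hm : ∀ i, ‖m i‖ ≤ C) (hm' : ∀ i, ‖m' i‖ ≤ C') :
    (diag m).comp (diag m') = diag fun i => m i * m' i := by
  refine L1.clm_ext fun i => ?_
  have h : ∀ i, ‖m i * m' i‖ ≤ C * C' := fun i => by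
    rw [norm_mul]
    exact mul_le_mul (hm i) (hm' i) (norm_nonneg _) ((norm_nonneg _).trans (hm i))
  rw [ContinuousLinearMap.comp_apply, diag_unitVec hm', map_smul, diag_unitVec hm, diag_unitVec h,
    smul_smul, mul_comm]

theorem diag_add (hm : ∀ i, ‖m i‖ ≤ C) (hm' : ∀ i, ‖m' i‖ ≤ C') :
    diag (fun i => m i + m' i) = diag m + diag m' := by
  refine L1.clm_ext fun i => ?_
  have h : ∀ i, ‖m i + m' i‖ ≤ C + C' := fun i =>
    (norm_add_le _ _).trans (add_le_add (hm i) (hm' i))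
  rw [add_apply, diag_unitVec hm', diag_unitVec hm, diag_unitVec h, add_smul]

theorem diag_smul (c : ℂ) (hm : ∀ i, ‖m i‖ ≤ C) :
    diag (fun i => c * m i) = c • diag m := by
  refine L1.clm_ext fun i => ?_
  have h : ∀ i, ‖c * m i‖ ≤ ‖c‖ * C := fun i => by
    rw [norm_mul]
    exact mul_le_mul_of_nonneg_left (hm i) (norm_nonneg _)
  rw [smul_apply, diag_unitVec hm, diag_unitVec h, mul_smul]

end L1

section Phase

theorem exists_succ_pow_mul_exp_neg_le (k : ℕ) {η : ℝ} (hη : 0 < η) :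
    ∃ B : ℝ, 0 ≤ B ∧ ∀ n : ℕ, ((n : ℝ) + 1) ^ k * Real.exp (-(η * n)) ≤ B := by
  refine ⟨k.factorial * Real.exp η / η ^ k, by positivity, fun n => ?_⟩
  have h := Real.pow_div_factorial_le_exp (η * (n + 1)) (by positivity) k
  rw [div_le_iff₀ (by positivity), mul_pow, mul_add_one, Real.exp_add] at h
  rw [le_div_iff₀ (by positivity), Real.exp_neg, mul_right_comm, ← div_eq_mul_inv,
    div_le_iff₀ (Real.exp_pos _)]
  linarith

theorem norm_exp_I_sub_one_sub_le (y : ℝ) :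
    ‖Complex.exp (Complex.I * y) - 1 - Complex.I * y‖ ≤ 2 * y ^ 2 := by
  have hn : ‖Complex.I * (y : ℂ)‖ = |y| := by
    rw [norm_mul, Complex.norm_I, one_mul, Complex.norm_real, Real.norm_eq_abs]
  rcases le_total |y| 1 with hy | hy
  · have h := Complex.norm_exp_sub_one_sub_id_le (x := Complex.I * y) (by rwa [hn])
    rw [hn, sq_abs] at h
    linarith [sq_nonneg y]
  · have h := (norm_sub_le _ _).trans (add_le_add (Complex.norm_exp_I_mul_ofReal_sub_one y).le
      hn.le)
    have h' : ‖2 * Real.sin (y / 2)‖ ≤ |y| := by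
      rw [← Complex.norm_exp_I_mul_ofReal_sub_one]
      exact Real.norm_exp_I_mul_ofReal_sub_one_le
    nlinarith [sq_abs y]

variable {ι : Type*} {Q : Type*} [NormedAddCommGroup Q] [NormedSpace ℝ Q]

/-- The symbol `e^{-η deg i + i θᵢ(q)}` of a phase rotation by linear phases `θᵢ` combined with
exponential damping in the degree. -/
def phaseSymbol (deg : ι → ℕ) (θ : ι → Q →L[ℝ] ℝ) (η : ℝ≥0) (q : Q) (i : ι) : ℂ :=
  Complex.exp ((-(η * deg i) : ℝ) + Complex.I * (θ i q : ℝ))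

variable {deg : ι → ℕ} {θ : ι → Q →L[ℝ] ℝ} {η η' : ℝ≥0}

theorem norm_phaseSymbol (q : Q) (i : ι) :
    ‖phaseSymbol deg θ η q i‖ = Real.exp (-(η * deg i)) := by
  simp [phaseSymbol, Complex.norm_exp]

theorem norm_phaseSymbol_le (q : Q) (i : ι) : ‖phaseSymbol deg θ η q i‖ ≤ 1 := by
  rw [norm_phaseSymbol, Real.exp_le_one_iff, neg_nonpos]
  positivity

theorem phaseSymbol_add (q q' : Q) (i : ι) :
    phaseSymbol deg θ (η + η') (q + q') i
      = phaseSymbol deg θ η q i * phaseSymbol deg θ η' q' i := by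
  rw [phaseSymbol, phaseSymbol, phaseSymbol, ← Complex.exp_add]
  congr 1
  push_cast [map_add]
  ring

theorem exists_norm_generator_symbol_le {C : ℝ} (hθ : ∀ i, ‖θ i‖ ≤ C * ((deg i : ℝ) + 1) ^ 2)
    (hη : 0 < η) :
    ∃ B : ℝ, 0 ≤ B ∧
      ∀ v i, ‖Complex.I * (θ i v : ℝ) * (Real.exp (-(η * deg i)) : ℝ)‖ ≤ B * ‖v‖ := by
  obtain ⟨B, hB0, hB⟩ := exists_succ_pow_mul_exp_neg_le 2 (NNReal.coe_pos.2 hη)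
  refine ⟨|C| * B, by positivity, fun v i => ?_⟩
  have hv : |θ i v| ≤ |C| * ((deg i : ℝ) + 1) ^ 2 * ‖v‖ :=
    (θ i).le_of_opNorm_le ((hθ i).trans (by gcongr; exact le_abs_self C)) v
  rw [norm_mul, norm_mul, Complex.norm_I, one_mul, Complex.norm_real, Complex.norm_real,
    Real.norm_eq_abs, Real.norm_of_nonneg (Real.exp_nonneg _)]
  calc |θ i v| * Real.exp (-(η * deg i))
      ≤ |C| * ((deg i : ℝ) + 1) ^ 2 * ‖v‖ * Real.exp (-(η * deg i)) := by gcongr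
    _ = |C| * (((deg i : ℝ) + 1) ^ 2 * Real.exp (-(η * deg i))) * ‖v‖ := by ring
    _ ≤ |C| * B * ‖v‖ := by gcongr; exact hB _

theorem exists_norm_phaseSymbol_taylor_le {C : ℝ} (hθ : ∀ i, ‖θ i‖ ≤ C * ((deg i : ℝ) + 1) ^ 2)
    (hη : 0 < η) (q : Q) :
    ∃ B : ℝ, 0 ≤ B ∧ ∀ v i, ‖phaseSymbol deg θ η (q + v) i - phaseSymbol deg θ η q i
      - Complex.I * (θ i v : ℝ) * phaseSymbol deg θ η q i‖ ≤ B * ‖v‖ ^ 2 := by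
  obtain ⟨B, hB0, hB⟩ := exists_succ_pow_mul_exp_neg_le 4 (NNReal.coe_pos.2 hη)
  refine ⟨2 * C ^ 2 * B, by positivity, fun v i => ?_⟩
  have hfactor : phaseSymbol deg θ η (q + v) i - phaseSymbol deg θ η q i
      - Complex.I * (θ i v : ℝ) * phaseSymbol deg θ η q i
      = phaseSymbol deg θ η q i
        * (Complex.exp (Complex.I * (θ i v : ℝ)) - 1 - Complex.I * (θ i v : ℝ)) := by
    have h := phaseSymbol_add (deg := deg) (θ := θ) (η := η) (η' := 0) q v i
    rw [add_zero] at h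
    rw [h, phaseSymbol.eq_def deg θ 0]
    simp only [NNReal.coe_zero, zero_mul, neg_zero, Complex.ofReal_zero, zero_add]
    ring
  have hθv : (θ i v) ^ 2 ≤ (C * ((deg i : ℝ) + 1) ^ 2 * ‖v‖) ^ 2 :=
    sq_le_sq.2 (((θ i).le_of_opNorm_le (hθ i) v).trans (le_abs_self _))
  rw [hfactor, norm_mul, norm_phaseSymbol]
  calc Real.exp (-(η * deg i)) * ‖_‖
      ≤ Real.exp (-(η * deg i)) * (2 * (C * ((deg i : ℝ) + 1) ^ 2 * ‖v‖) ^ 2) := by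
        gcongr
        exact (norm_exp_I_sub_one_sub_le _).trans (by gcongr)
    _ = 2 * C ^ 2 * (((deg i : ℝ) + 1) ^ 4 * Real.exp (-(η * deg i))) * ‖v‖ ^ 2 := by ring
    _ ≤ 2 * C ^ 2 * B * ‖v‖ ^ 2 := by gcongr; exact hB _

variable [DecidableEq ι]

variable (deg θ) in
/-- The operator `(aᵢ) ↦ (e^{-η deg i + i θᵢ(q)} aᵢ)`. For `η = 0` it is the free evolution; the
damping `η > 0` makes it a smooth function of `q`. -/
def phase (η : ℝ≥0) (q : Q) : L1 ι →L[ℂ] L1 ι := diag (phaseSymbol deg θ η q)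

/-- The operator `(aᵢ) ↦ (e^{-η deg i} aᵢ)`. -/
def damping (deg : ι → ℕ) (η : ℝ≥0) : L1 ι →L[ℂ] L1 ι :=
  diag fun i => (Real.exp (-(η * deg i)) : ℂ)

theorem phase_unitVec (q : Q) (i : ι) :
    phase deg θ η q (unitVec i) = phaseSymbol deg θ η q i • unitVec i :=
  diag_unitVec (norm_phaseSymbol_le q) i

theorem norm_phase_apply_le (q : Q) (a : L1 ι) : ‖phase deg θ η q a‖ ≤ ‖a‖ :=
  (norm_diag_apply_le (norm_phaseSymbol_le q) a).trans_eq (one_mul _)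

theorem phase_phase (q q' : Q) (a : L1 ι) :
    phase deg θ η q (phase deg θ η' q' a) = phase deg θ (η + η') (q + q') a := by
  rw [← ContinuousLinearMap.comp_apply, phase, phase,
    diag_comp (norm_phaseSymbol_le q) (norm_phaseSymbol_le q')]
  simp only [← phaseSymbol_add]
  rfl

theorem phase_zero_right : phase deg θ η 0 = damping deg η := by
  rw [phase, damping]
  congr 1
  funext i
  rw [phaseSymbol, map_zero, Complex.ofReal_zero, mul_zero, add_zero, Complex.ofReal_exp]

theorem phase_zero_zero : phase deg θ 0 0 = 1 :=
  L1.clm_ext fun i => by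
    rw [phase_unitVec, phaseSymbol]
    simp

theorem continuous_phase_apply (a : L1 ι) : Continuous fun q => phase deg θ η q a := by
  have h : (fun q => phase deg θ η q a)
      = fun q => ∑' i, a i • (phaseSymbol deg θ η q i • unitVec i) :=
    funext fun q => l1Lift_apply (norm_smul_unitVec_le (norm_phaseSymbol_le q)) a
  rw [h]
  refine continuous_tsum (u := fun i => ‖a i‖) (fun i => ?_) a.summable_norm (fun i q => ?_)
  · unfold phaseSymbol
    fun_prop
  · rw [norm_smul]
    exact mul_le_of_le_one_right (norm_nonneg _)
      (norm_smul_unitVec_le (norm_phaseSymbol_le q) i)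

theorem continuous_phase_apply_of_continuous {Y : Type*} [TopologicalSpace Y] {q : Y → Q}
    {a : Y → L1 ι} (hq : Continuous q) (ha : Continuous a) :
    Continuous fun y => phase deg θ η (q y) (a y) := by
  rw [continuous_iff_continuousAt]
  intro y₀
  have h1 : Filter.Tendsto (fun y => phase deg θ η (q y) (a y₀)) (𝓝 y₀)
      (𝓝 (phase deg θ η (q y₀) (a y₀))) :=
    ((continuous_phase_apply (a y₀)).comp hq).tendsto y₀
  have h2 : Filter.Tendsto (fun y => phase deg θ η (q y) (a y - a y₀)) (𝓝 y₀) (𝓝 0) := by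
    refine squeeze_zero_norm (fun y => norm_phase_apply_le _ _) ?_
    have : Continuous fun y => ‖a y - a y₀‖ := by fun_prop
    simpa using this.tendsto y₀
  have h3 := h1.add h2
  rw [add_zero] at h3
  refine h3.congr fun y => ?_
  rw [← map_add, add_sub_cancel]

/-- The generator `v ↦ ((aᵢ) ↦ (i θᵢ(v) e^{-η deg i} aᵢ))` of the phases. The damping absorbs the
polynomial growth of `θᵢ` in the degree, so that it is bounded. -/
def phaseGen {C : ℝ} (hθ : ∀ i, ‖θ i‖ ≤ C * ((deg i : ℝ) + 1) ^ 2) (hη : 0 < η) :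
    Q →L[ℝ] (L1 ι →L[ℂ] L1 ι) :=
  LinearMap.mkContinuous
    { toFun := fun v => diag fun i => Complex.I * (θ i v : ℝ) * (Real.exp (-(η * deg i)) : ℝ)
      map_add' := fun v w => by
        have hB := (exists_norm_generator_symbol_le hθ hη).choose_spec.2
        rw [← diag_add (hB v) (hB w)]
        congr 1
        funext i
        push_cast [map_add]
        ring
      map_smul' := fun c v => by
        have hB := (exists_norm_generator_symbol_le hθ hη).choose_spec.2
        refine Eq.trans ?_ (diag_smul (c : ℂ) (hB v))
        congr 1
        funext i
        push_cast [map_smul, smul_eq_mul]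
        ring }
    (exists_norm_generator_symbol_le hθ hη).choose
    (fun v => norm_diag_le
      (mul_nonneg (exists_norm_generator_symbol_le hθ hη).choose_spec.1 (norm_nonneg v))
      ((exists_norm_generator_symbol_le hθ hη).choose_spec.2 v))

theorem phaseGen_unitVec {C : ℝ} (hθ : ∀ i, ‖θ i‖ ≤ C * ((deg i : ℝ) + 1) ^ 2) (hη : 0 < η)
    (v : Q) (i : ι) :
    phaseGen hθ hη v (unitVec i)
      = (Complex.I * (θ i v : ℝ) * (Real.exp (-(η * deg i)) : ℝ)) • unitVec i :=
  diag_unitVec ((exists_norm_generator_symbol_le hθ hη).choose_spec.2 v) i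

theorem phaseGen_phase_unitVec {C : ℝ} (hθ : ∀ i, ‖θ i‖ ≤ C * ((deg i : ℝ) + 1) ^ 2) (hη : 0 < η)
    (v q : Q) (i : ι) :
    phaseGen hθ hη v (phase deg θ η' q (unitVec i))
      = (Complex.I * (θ i v : ℝ)) • phase deg θ (η + η') q (unitVec i) := by
  have hsymbol : (Real.exp (-(η * deg i)) : ℝ) * phaseSymbol deg θ η' q i
      = phaseSymbol deg θ (η + η') q i := by
    have h := phaseSymbol_add (deg := deg) (θ := θ) (η := η) (η' := η') 0 q i
    rw [zero_add] at h
    rw [h]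
    simp [phaseSymbol]
  rw [phase_unitVec, phase_unitVec, map_smul, phaseGen_unitVec, smul_smul, smul_smul, ← hsymbol]
  congr 1
  ring

theorem hasFDerivAt_phase {C : ℝ} (hθ : ∀ i, ‖θ i‖ ≤ C * ((deg i : ℝ) + 1) ^ 2) (hη : 0 < η)
    (q : Q) :
    HasFDerivAt (phase deg θ (η + η'))
      (((ContinuousLinearMap.mul ℝ (L1 ι →L[ℂ] L1 ι)).flip (phase deg θ η' q)).comp
        (phaseGen hθ hη)) q := by
  obtain ⟨B, hB0, hB⟩ := exists_norm_phaseSymbol_taylor_le hθ (add_pos_of_pos_of_nonneg hη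
    (zero_le : 0 ≤ η')) q
  refine .of_isLittleO ((Asymptotics.IsBigO.of_bound B (.of_forall fun q' => ?_)).trans_isLittleO
    (Asymptotics.isLittleO_pow_sub_sub q one_lt_two))
  have hremainder : phase deg θ (η + η') q' - phase deg θ (η + η') q
      - phaseGen hθ hη (q' - q) * phase deg θ η' q
      = diag fun i => phaseSymbol deg θ (η + η') (q + (q' - q)) i - phaseSymbol deg θ (η + η') q i
        - Complex.I * (θ i (q' - q) : ℝ) * phaseSymbol deg θ (η + η') q i := by
    refine L1.clm_ext fun i => ?_
    rw [diag_unitVec (hB _), sub_smul, sub_smul, add_sub_cancel, mul_smul, ← phase_unitVec,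
      ← phase_unitVec, ← phaseGen_phase_unitVec hθ hη]
    rfl
  change ‖_ - _ - phaseGen hθ hη (q' - q) * phase deg θ η' q‖ ≤ _
  rw [hremainder, Real.norm_of_nonneg (by positivity)]
  exact norm_diag_le (by positivity) (hB _)

theorem contDiff_phase {C : ℝ} (hθ : ∀ i, ‖θ i‖ ≤ C * ((deg i : ℝ) + 1) ^ 2) (hη : 0 < η) :
    ContDiff ℝ ∞ (phase deg θ η) := by
  rw [contDiff_infty]
  intro n
  -- Half of the damping pays for the derivative, the other half for the induction.
  have hderiv : ∀ η : ℝ≥0, (hη : 0 < η) → ∀ q, HasFDerivAt (phase deg θ η)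
      (((ContinuousLinearMap.mul ℝ (L1 ι →L[ℂ] L1 ι)).flip (phase deg θ (η / 2) q)).comp
        (phaseGen hθ (half_pos hη))) q := fun η hη q => by
    simpa only [add_halves] using hasFDerivAt_phase (η' := η / 2) hθ (half_pos hη) q
  induction n generalizing η with
  | zero =>
    exact contDiff_zero.2 (continuous_iff_continuousAt.2 fun q => (hderiv η hη q).continuousAt)
  | succ n ih =>
    refine contDiff_succ_iff_hasFDerivAt.2 ⟨_, ?_, hderiv η hη⟩
    exact ((ContinuousLinearMap.contDiff _).comp (ih (half_pos hη))).clm_comp contDiff_const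

end Phase

section PicardLindelof

variable {E : Type*} [NormedAddCommGroup E] {G : ℝ → E → E} {x₀ : E}

theorem continuous_of_lipschitzOnWith {S : Set E} {L : ℝ≥0} {a : ℝ → E}
    (hcont : ∀ x, Continuous fun t => G t x) (hlip : ∀ t, LipschitzOnWith L (G t) S)
    (ha : Continuous a) (hmem : ∀ t, a t ∈ S) : Continuous fun t => G t (a t) := by
  have h : ContinuousOn (Function.uncurry G) (Set.univ ×ˢ S) :=
    continuousOn_prod_of_continuousOn_lipschitzOnWith' _ L (fun t _ => hlip t)
      (fun x _ => (hcont x).continuousOn)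
  rw [← continuousOn_univ]
  exact h.comp (f := fun t => (t, a t)) (by fun_prop) fun t _ => ⟨trivial, hmem t⟩

variable [NormedSpace ℝ E]

theorem exists_picard_fixedPoint [CompleteSpace E] {tmin tmax : ℝ} {t₀ : Set.Icc tmin tmax}
    {R B L : ℝ≥0} (hG : IsPicardLindelof G t₀ x₀ R 0 B L) :
    ∃ a : ℝ → E, Continuous a ∧ (∀ t, a t ∈ Metric.closedBall x₀ R) ∧
      ∀ t ∈ Set.Icc tmin tmax, a t = ODE.picard G t₀ x₀ a t := by
  have hx₀ : x₀ ∈ Metric.closedBall x₀ (0 : ℝ≥0) := Metric.mem_closedBall_self le_rfl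
  obtain ⟨α, hα⟩ := ODE.FunSpace.exists_isFixedPt_next hG hx₀
  refine ⟨α.compProj, α.continuous_compProj, fun t => α.compProj_mem_closedBall hG.mul_max_le,
    fun t ht => ?_⟩
  have h := ODE.FunSpace.next_apply hG hx₀ α (t := ⟨t, ht⟩)
  rw [hα.eq] at h
  rw [ODE.FunSpace.compProj_apply, Set.projIcc_of_mem _ ht]
  exact h

theorem norm_sub_first_picard_iterate_le {S : Set E} {L B : ℝ≥0} {a : ℝ → E} {t : ℝ}
    (hcont : ∀ x, Continuous fun t => G t x) (hlip : ∀ t, LipschitzOnWith L (G t) S)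
    (hbound : ∀ t, ∀ x ∈ S, ‖G t x‖ ≤ B) (hx₀ : x₀ ∈ S) (ha : Continuous a)
    (hmem : ∀ t, a t ∈ S) (ht : 0 ≤ t)
    (hpicard : ∀ u ∈ Set.Icc 0 t, a u = x₀ + ∫ v in (0 : ℝ)..u, G v (a v)) :
    ‖a t - x₀ - ∫ u in (0 : ℝ)..t, G u x₀‖ ≤ L * B * t ^ 2 := by
  have hGa := continuous_of_lipschitzOnWith hcont hlip ha hmem
  have hdrift : ∀ u ∈ Set.Icc 0 t, ‖a u - x₀‖ ≤ B * u := fun u hu => by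
    rw [hpicard u hu, add_sub_cancel_left]
    simpa [abs_of_nonneg hu.1] using intervalIntegral.norm_integral_le_of_norm_le_const
      (a := 0) (b := u) (f := fun v => G v (a v)) fun v _ => hbound v _ (hmem v)
  rw [hpicard t ⟨ht, le_rfl⟩, add_sub_cancel_left, ← intervalIntegral.integral_sub
    (hGa.intervalIntegrable _ _) ((hcont x₀).intervalIntegrable _ _)]
  have hintegrand : ∀ u ∈ Set.uIoc 0 t, ‖G u (a u) - G u x₀‖ ≤ L * (B * t) := fun u hu => by
    rw [Set.uIoc_of_le ht] at hu
    calc ‖G u (a u) - G u x₀‖ ≤ L * ‖a u - x₀‖ := (hlip u).norm_sub_le (hmem u) hx₀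
      _ ≤ L * (B * u) := by gcongr; exact hdrift u ⟨hu.1.le, hu.2⟩
      _ ≤ L * (B * t) := by gcongr; exact hu.2
  refine (intervalIntegral.norm_integral_le_of_norm_le_const hintegrand).trans_eq ?_
  rw [sub_zero, abs_of_nonneg ht]
  ring

theorem exists_ode_solution_near_first_picard_iterate [CompleteSpace E] {R B L : ℝ≥0} {τ : ℝ}
    (hτ : 0 < τ) (hcont : ∀ x, Continuous fun t => G t x)
    (hbound : ∀ t, ∀ x ∈ Metric.closedBall x₀ R, ‖G t x‖ ≤ B)
    (hlip : ∀ t, LipschitzOnWith L (G t) (Metric.closedBall x₀ R)) (hBτ : B * τ ≤ R) :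
    ∃ a : ℝ → E, a 0 = x₀ ∧ (∀ t ∈ Set.Ioo (-τ) τ, HasDerivAt a (G t (a t)) t) ∧
      ∀ t ∈ Set.Ico 0 τ, ‖a t - x₀ - ∫ u in (0 : ℝ)..t, G u x₀‖ ≤ L * B * t ^ 2 := by
  have h0 : (0 : ℝ) ∈ Set.Icc (-τ) τ := ⟨neg_nonpos.2 hτ.le, hτ.le⟩
  have hpl : IsPicardLindelof G (tmin := -τ) (tmax := τ) ⟨0, h0⟩ x₀ R 0 B L :=
    ⟨fun t _ => hlip t, fun x _ => (hcont x).continuousOn, fun t _ => hbound t, by simpa using hBτ⟩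
  obtain ⟨a, ha, hmem, hpicard⟩ := exists_picard_fixedPoint hpl
  refine ⟨a, ?_, fun t ht => ?_, fun t ht => ?_⟩
  · rw [hpicard 0 h0, ODE.picard_apply₀]
  · have h : HasDerivAt (fun t => x₀ + ∫ u in (0 : ℝ)..t, G u (a u)) (G t (a t)) t :=
      ((continuous_of_lipschitzOnWith hcont hlip ha hmem).integral_hasStrictDerivAt
        0 t).hasDerivAt.const_add x₀
    refine h.congr_of_eventuallyEq ?_
    filter_upwards [Ioo_mem_nhds ht.1 ht.2] with u hu
    exact hpicard u ⟨hu.1.le, hu.2.le⟩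
  · exact norm_sub_first_picard_iterate_le hcont hlip hbound
      (Metric.mem_closedBall_self R.2) ha hmem ht.1 fun u hu =>
        hpicard u ⟨by linarith [hu.1], hu.2.trans ht.2.le⟩

end PicardLindelof

section Convolution

variable {ι : Type*} [DecidableEq ι]

theorem norm_l1Lift_unitVec_le {κ : Type*} (f : κ → ι) : ‖l1Lift fun j => unitVec (f j)‖ ≤ 1 :=
  norm_l1Lift_le zero_le_one fun j => (norm_unitVec (f j)).le

theorem L1.bilin_ext {E : Type*} [NormedAddCommGroup E] [NormedSpace ℂ E]
    {F G : L1 ι →L[ℂ] L1 ι →L[ℂ] E}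
    (h : ∀ i j, F (unitVec i) (unitVec j) = G (unitVec i) (unitVec j)) : F = G :=
  L1.clm_ext fun i => L1.clm_ext fun j => h i j

variable [Add ι]

/-- The convolution product on `ℓ¹(ι)`, the Fourier side of the pointwise product. -/
def conv : L1 ι →L[ℂ] L1 ι →L[ℂ] L1 ι := l1Lift fun i => l1Lift fun j => unitVec (i + j)

@[simp] theorem conv_unitVec (i j : ι) : conv (unitVec i) (unitVec j) = unitVec (i + j) := by
  rw [conv, l1Lift_unitVec fun i => norm_l1Lift_unitVec_le _,
    l1Lift_unitVec fun j => (norm_unitVec _).le]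

theorem norm_conv_le (a b : L1 ι) : ‖conv a b‖ ≤ ‖a‖ * ‖b‖ := by
  have h : ‖(conv : L1 ι →L[ℂ] L1 ι →L[ℂ] L1 ι)‖ ≤ 1 :=
    norm_l1Lift_le zero_le_one fun i => norm_l1Lift_unitVec_le _
  refine (ContinuousLinearMap.le_opNorm₂ _ a b).trans ?_
  rw [mul_assoc]
  exact mul_le_of_le_one_left (by positivity) h

theorem contDiff_conv {Y : Type*} [NormedAddCommGroup Y] [NormedSpace ℝ Y] {f g : Y → L1 ι}
    {n : WithTop ℕ∞} (hf : ContDiff ℝ n f) (hg : ContDiff ℝ n g) :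
    ContDiff ℝ n fun y => conv (f y) (g y) :=
  (conv.bilinearRestrictScalars ℝ).isBoundedBilinearMap.contDiff.comp (hf.prodMk hg)

theorem diag_conv {χ : ι → ℂ} {C : ℝ} (hC : ∀ i, ‖χ i‖ ≤ C)
    (hχ : ∀ i j, χ (i + j) = χ i * χ j) (a b : L1 ι) :
    diag χ (conv a b) = conv (diag χ a) (diag χ b) := by
  have h : (ContinuousLinearMap.compL ℂ (L1 ι) (L1 ι) (L1 ι) (diag χ)).comp conv
      = conv.bilinearComp (diag χ) (diag χ) := by
    refine L1.bilin_ext fun i j => ?_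
    change diag χ (conv (unitVec i) (unitVec j)) = conv (diag χ (unitVec i)) (diag χ (unitVec j))
    rw [conv_unitVec, diag_unitVec hC, diag_unitVec hC, diag_unitVec hC, map_smul,
      map_smul, smul_apply, conv_unitVec, smul_smul, hχ, mul_comm]
  exact DFunLike.congr_fun (DFunLike.congr_fun h a) b

theorem l1Lift_conv {χ : ι → ℂ} {C : ℝ} (hC : ∀ i, ‖χ i‖ ≤ C)
    (hχ : ∀ i j, χ (i + j) = χ i * χ j) (a b : L1 ι) :
    l1Lift χ (conv a b) = l1Lift χ a * l1Lift χ b := by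
  have h : (ContinuousLinearMap.compL ℂ (L1 ι) (L1 ι) ℂ (l1Lift χ)).comp conv
      = (ContinuousLinearMap.mul ℂ ℂ).bilinearComp (l1Lift χ) (l1Lift χ) := by
    refine L1.bilin_ext fun i j => ?_
    change l1Lift χ (conv (unitVec i) (unitVec j)) = l1Lift χ (unitVec i) * l1Lift χ (unitVec j)
    rw [conv_unitVec, l1Lift_unitVec hC, l1Lift_unitVec hC, l1Lift_unitVec hC, hχ]
  exact DFunLike.congr_fun (DFunLike.congr_fun h a) b

end Convolution

section Conjugation

variable {ι : Type*} [DecidableEq ι]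

/-- The antilinear map on `ℓ¹(ι)` sending the unit vector `i` to the unit vector `τ i`. For
`τ = -·` on frequencies, it is the Fourier side of complex conjugation. -/
def conjMap (τ : ι → ι) : L1 ι →L[ℝ] L1 ι :=
  ((l1Lift fun i => unitVec (τ i)).restrictScalars ℝ).comp
    (starL' ℝ : L1 ι ≃L[ℝ] L1 ι).toContinuousLinearMap

theorem conjMap_apply (τ : ι → ι) (a : L1 ι) :
    conjMap τ a = l1Lift (fun i => unitVec (τ i)) (star a) := rfl

theorem star_unitVec (i : ι) : star (unitVec i) = unitVec i := by
  refine lp.ext (funext fun j => ?_)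
  rw [lp.star_apply, unitVec_apply]
  split_ifs
  · exact star_one ℂ
  · exact star_zero ℂ

theorem conjMap_smul_unitVec (τ : ι → ι) (c : ℂ) (i : ι) :
    conjMap τ (c • unitVec i) = (starRingEnd ℂ) c • unitVec (τ i) := by
  rw [conjMap_apply, star_smul, star_unitVec, map_smul,
    l1Lift_unitVec fun j => (norm_unitVec _).le]
  rfl

theorem l1Lift_conjMap {χ : ι → ℂ} {C : ℝ} (hC : ∀ i, ‖χ i‖ ≤ C) {τ : ι → ι}
    (hχ : ∀ i, χ (τ i) = (starRingEnd ℂ) (χ i)) (a : L1 ι) :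
    l1Lift χ (conjMap τ a) = (starRingEnd ℂ) (l1Lift χ a) := by
  have hC' : ∀ i, ‖χ (τ i)‖ ≤ C := fun i => hC _
  have hcomp : (l1Lift χ).comp (l1Lift fun i => unitVec (τ i)) = l1Lift fun i => χ (τ i) := by
    refine L1.clm_ext fun i => ?_
    rw [ContinuousLinearMap.comp_apply, l1Lift_unitVec fun j => (norm_unitVec _).le,
      l1Lift_unitVec hC, l1Lift_unitVec hC']
  rw [conjMap_apply, ← ContinuousLinearMap.comp_apply, hcomp, l1Lift_apply hC', l1Lift_apply hC,
    Complex.conj_tsum]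
  refine tsum_congr fun i => ?_
  rw [hχ, smul_eq_mul, smul_eq_mul, map_mul]
  rfl

theorem diag_conjMap {m : ι → ℂ} {C : ℝ} (hm : ∀ i, ‖m i‖ ≤ C) {τ : ι → ι}
    (hmτ : ∀ i, m (τ i) = (starRingEnd ℂ) (m i)) (a : L1 ι) :
    diag m (conjMap τ a) = conjMap τ (diag m a) := by
  have hm' : ∀ i, ‖(starRingEnd ℂ) (m i)‖ ≤ C := fun i => (RCLike.norm_conj _).trans_le (hm i)
  have hcomp : (diag m).comp (l1Lift fun i => unitVec (τ i))
      = (l1Lift fun i => unitVec (τ i)).comp (diag fun i => (starRingEnd ℂ) (m i)) := by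
    refine L1.clm_ext fun i => ?_
    rw [ContinuousLinearMap.comp_apply, ContinuousLinearMap.comp_apply, diag_unitVec hm', map_smul,
      l1Lift_unitVec fun j => (norm_unitVec _).le, diag_unitVec hm, hmτ]
  have hstar : diag (fun i => (starRingEnd ℂ) (m i)) (star a) = star (diag m a) := by
    refine lp.ext (funext fun j => ?_)
    rw [lp.star_apply, diag_apply hm, diag_apply hm', lp.star_apply, star_mul']
    rfl
  rw [conjMap_apply, conjMap_apply, ← hstar]
  exact DFunLike.congr_fun hcomp (star a)

end Conjugation

section Nonlinearity

variable {ι : Type*} {deg : ι → ℕ} {τ : ι → ι} {m n : ℕ} {F G : L1 ι → L1 ι}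

theorem norm_le_of_lipschitzOnWith (hF : F 0 = 0) {C R : ℝ≥0}
    (hC : LipschitzOnWith (C * R ^ n) F (Metric.closedBall 0 R)) {u : L1 ι} (hu : ‖u‖ ≤ R) :
    ‖F u‖ ≤ C * R ^ (n + 1) := by
  have h := hC.norm_sub_le (mem_closedBall_zero_iff.2 hu) (Metric.mem_closedBall_self R.2)
  rw [hF, sub_zero, sub_zero] at h
  refine h.trans ?_
  push_cast
  rw [pow_succ, ← mul_assoc]
  gcongr

theorem norm_exp_neg_deg_le (deg : ι → ℕ) (η : ℝ≥0) (i : ι) :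
    ‖(Real.exp (-(η * deg i)) : ℂ)‖ ≤ 1 := by
  rw [Complex.norm_real, Real.norm_of_nonneg (Real.exp_nonneg _), Real.exp_le_one_iff, neg_nonpos]
  positivity

variable [DecidableEq ι]

theorem damping_unitVec (η : ℝ≥0) (i : ι) :
    damping deg η (unitVec i) = (Real.exp (-(η * deg i)) : ℂ) • unitVec i :=
  diag_unitVec (norm_exp_neg_deg_le deg η) i

theorem conjMap_damping (hτ : ∀ i, deg (τ i) = deg i) (η : ℝ≥0) (u : L1 ι) :
    conjMap τ (damping deg η u) = damping deg η (conjMap τ u) :=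
  (diag_conjMap (norm_exp_neg_deg_le deg η) (fun i => by rw [hτ, Complex.conj_ofReal]) u).symm

theorem diag_damping {χ : ι → ℂ} {C : ℝ} (hχ : ∀ i, ‖χ i‖ ≤ C) (η : ℝ≥0) (u : L1 ι) :
    diag χ (damping deg η u) = damping deg η (diag χ u) := by
  rw [damping, ← ContinuousLinearMap.comp_apply, ← ContinuousLinearMap.comp_apply,
    diag_comp hχ (norm_exp_neg_deg_le deg η), diag_comp (norm_exp_neg_deg_le deg η) hχ]
  simp only [mul_comm]

theorem damping_conv [Add ι] (hdeg : ∀ i j, deg (i + j) = deg i + deg j) (η : ℝ≥0) (u v : L1 ι) :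
    damping deg η (conv u v) = conv (damping deg η u) (damping deg η v) :=
  diag_conv (norm_exp_neg_deg_le deg η) (fun i j => by
    rw [hdeg, ← Complex.ofReal_mul, ← Real.exp_add]
    congr 2
    push_cast
    ring) u v

/-- A nonlinearity on `ℓ¹(ι)` for which the equation can be solved: smooth, Lipschitz on balls with
a constant of order `R ^ n`, and compatible with the grading. -/
structure IsAdmissible (deg : ι → ℕ) (n : ℕ) (F : L1 ι → L1 ι) : Prop where
  map_zero : F 0 = 0
  exists_lipschitzOnWith :
    ∃ C : ℝ≥0, ∀ R : ℝ≥0, LipschitzOnWith (C * R ^ n) F (Metric.closedBall 0 R)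
  contDiff : ContDiff ℝ ∞ F
  map_damping : ∀ η u, F (damping deg η u) = damping deg η (F u)

theorem IsAdmissible.id : IsAdmissible deg 0 fun u : L1 ι => u where
  map_zero := rfl
  exists_lipschitzOnWith := ⟨1, fun R => by
    rw [pow_zero, mul_one]
    exact LipschitzWith.id.lipschitzOnWith⟩
  contDiff := contDiff_id
  map_damping _ _ := rfl

theorem IsAdmissible.clm_comp (hF : IsAdmissible deg n F) (T : L1 ι →L[ℝ] L1 ι)
    (hT : ∀ η u, T (damping deg η u) = damping deg η (T u)) :
    IsAdmissible deg n fun u => T (F u) where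
  map_zero := by rw [hF.map_zero, _root_.map_zero]
  exists_lipschitzOnWith := by
    obtain ⟨C, hC⟩ := hF.exists_lipschitzOnWith
    refine ⟨‖T‖₊ * C, fun R => ?_⟩
    rw [mul_assoc]
    exact T.lipschitz.comp_lipschitzOnWith (hC R)
  contDiff := T.contDiff.comp hF.contDiff
  map_damping η u := by rw [hF.map_damping, hT]

theorem IsAdmissible.smul (hF : IsAdmissible deg n F) (c : ℂ) :
    IsAdmissible deg n fun u => c • F u :=
  hF.clm_comp ((c • ContinuousLinearMap.id ℂ (L1 ι)).restrictScalars ℝ) fun η u =>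
    ((damping deg η).map_smul c u).symm

theorem IsAdmissible.add (hF : IsAdmissible deg n F) (hG : IsAdmissible deg n G) :
    IsAdmissible deg n fun u => F u + G u where
  map_zero := by rw [hF.map_zero, hG.map_zero, add_zero]
  exists_lipschitzOnWith := by
    obtain ⟨C, hC⟩ := hF.exists_lipschitzOnWith
    obtain ⟨D, hD⟩ := hG.exists_lipschitzOnWith
    refine ⟨C + D, fun R => ?_⟩
    rw [add_mul]
    exact (hC R).add (hD R)
  contDiff := hF.contDiff.add hG.contDiff
  map_damping η u := by rw [hF.map_damping, hG.map_damping, map_add]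

variable [Add ι]

theorem IsAdmissible.mul (hF : IsAdmissible deg m F) (hG : IsAdmissible deg n G)
    (hdeg : ∀ i j, deg (i + j) = deg i + deg j) :
    IsAdmissible deg (m + n + 1) fun u => conv (F u) (G u) where
  map_zero := by rw [hF.map_zero, _root_.map_zero, zero_apply]
  exists_lipschitzOnWith := by
    obtain ⟨C, hC⟩ := hF.exists_lipschitzOnWith
    obtain ⟨D, hD⟩ := hG.exists_lipschitzOnWith
    refine ⟨2 * (C * D), fun R => LipschitzOnWith.of_dist_le_mul fun u hu v hv => ?_⟩
    have hG_u := norm_le_of_lipschitzOnWith hG.map_zero (hD R) (mem_closedBall_zero_iff.1 hu)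
    have hF_v := norm_le_of_lipschitzOnWith hF.map_zero (hC R) (mem_closedBall_zero_iff.1 hv)
    have hF_sub := (hC R).norm_sub_le hu hv
    have hG_sub := (hD R).norm_sub_le hu hv
    have hsplit : conv (F u) (G u) - conv (F v) (G v)
        = conv (F u - F v) (G u) + conv (F v) (G u - G v) := by
      simp only [map_sub, sub_apply, sub_add_sub_cancel]
    rw [dist_eq_norm, dist_eq_norm, hsplit]
    push_cast at hF_sub hG_sub ⊢
    calc ‖conv (F u - F v) (G u) + conv (F v) (G u - G v)‖
        ≤ ‖F u - F v‖ * ‖G u‖ + ‖F v‖ * ‖G u - G v‖ :=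
          (norm_add_le _ _).trans (add_le_add (norm_conv_le _ _) (norm_conv_le _ _))
      _ ≤ C * R ^ m * ‖u - v‖ * (D * R ^ (n + 1)) + C * R ^ (m + 1) * (D * R ^ n * ‖u - v‖) := by
          gcongr
      _ = 2 * (C * D) * R ^ (m + n + 1) * ‖u - v‖ := by ring
  contDiff := contDiff_conv hF.contDiff hG.contDiff
  map_damping η u := by rw [hF.map_damping, hG.map_damping, damping_conv hdeg]

/-- The nonlinearity `|u|^{2n} u` on the Fourier side. -/
def oddPower (τ : ι → ι) : ℕ → L1 ι → L1 ι
  | 0, u => u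
  | n + 1, u => conv u (conv (conjMap τ u) (oddPower τ n u))

theorem oddPower_isAdmissible (hdeg : ∀ i j, deg (i + j) = deg i + deg j)
    (hτ : ∀ i, deg (τ i) = deg i) : ∀ n, IsAdmissible deg (2 * n) (oddPower τ n)
  | 0 => .id
  | n + 1 => by
    have h := IsAdmissible.id.mul (((IsAdmissible.id (deg := deg)).clm_comp (conjMap τ)
      (conjMap_damping hτ)).mul (oddPower_isAdmissible hdeg hτ n) hdeg) hdeg
    rwa [zero_add, zero_add] at h

/-- The nonlinearity `(∫ |u|²) u` on the Fourier side, where `χ` is the indicator of the zero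
frequency. -/
def massTerm (τ : ι → ι) (χ : ι → ℂ) (u : L1 ι) : L1 ι := conv (diag χ (conv u (conjMap τ u))) u

theorem massTerm_isAdmissible (hdeg : ∀ i j, deg (i + j) = deg i + deg j)
    (hτ : ∀ i, deg (τ i) = deg i) {χ : ι → ℂ} {C : ℝ} (hχ : ∀ i, ‖χ i‖ ≤ C) :
    IsAdmissible deg 2 (massTerm τ χ) :=
  ((IsAdmissible.id.mul (IsAdmissible.id.clm_comp (conjMap τ) (conjMap_damping hτ))
    hdeg).clm_comp ((diag χ).restrictScalars ℝ) (diag_damping hχ)).mul .id hdeg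

end Nonlinearity

section Flow

variable {ι : Type*} [DecidableEq ι] {Q : Type*} [NormedAddCommGroup Q] [NormedSpace ℝ Q]
  {deg : ι → ℕ} {θ : ι → Q →L[ℝ] ℝ} {η η' : ℝ≥0} {C : ℝ} {n : ℕ} {F : L1 ι → L1 ι}

theorem phase_damping (q : Q) (a : L1 ι) :
    phase deg θ η q (damping deg η' a) = phase deg θ (η + η') q a := by
  rw [← phase_zero_right (θ := θ), phase_phase, add_zero]

theorem damping_phase (q : Q) (a : L1 ι) :
    damping deg η (phase deg θ η' q a) = phase deg θ (η + η') q a := by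
  rw [← phase_zero_right (θ := θ), phase_phase, zero_add]

theorem contDiffOn_phase_apply (hθ : ∀ i, ‖θ i‖ ≤ C * ((deg i : ℝ) + 1) ^ 2) (hη : 0 < η)
    {X : Type*} [NormedAddCommGroup X] [NormedSpace ℝ X] {s : Set X} {q : X → Q} {a : X → L1 ι}
    {k : ℕ∞} (hq : ContDiffOn ℝ k q s) (ha : ContDiffOn ℝ k a s) :
    ContDiffOn ℝ k (fun x => phase deg θ η (q x) (a x)) s :=
  ((ContinuousLinearMap.restrictScalarsL ℂ (L1 ι) (L1 ι) ℝ ℝ).contDiff.comp_contDiffOn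
    (((contDiff_phase hθ hη).of_le (by exact_mod_cast le_top)).comp_contDiffOn hq)).clm_apply ha

theorem hasDerivAt_phase_apply (hθ : ∀ i, ‖θ i‖ ≤ C * ((deg i : ℝ) + 1) ^ 2) (hη : 0 < η)
    (q v : Q) {a : ℝ → L1 ι} {a' : L1 ι} {y : ℝ} (ha : HasDerivAt a a' y) :
    HasDerivAt (fun y : ℝ => phase deg θ (η + η') (q + y • v) (a y))
      (phaseGen hθ hη v (phase deg θ η' (q + y • v) (a y))
        + phase deg θ (η + η') (q + y • v) a') y := by
  have hline : HasDerivAt (fun y : ℝ => q + y • v) v y := by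
    simpa using ((hasDerivAt_id y).smul_const v).const_add q
  exact ((ContinuousLinearMap.restrictScalarsL ℂ (L1 ι) (L1 ι) ℝ ℝ).hasFDerivAt.comp_hasDerivAt y
    ((hasFDerivAt_phase hθ hη _).comp_hasDerivAt y hline)).clm_apply ha

theorem iteratedDeriv_two_phase_apply (hθ : ∀ i, ‖θ i‖ ≤ C * ((deg i : ℝ) + 1) ^ 2) (hη : 0 < η)
    (Λ : L1 ι →L[ℂ] ℂ) (q v : Q) (a : L1 ι) :
    iteratedDeriv 2 (fun y : ℝ => Λ (phase deg θ (η + (η + η')) (q + y • v) a))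
      = fun y => Λ (phaseGen hθ hη v (phaseGen hθ hη v (phase deg θ η' (q + y • v) a))) := by
  have hΛ : ∀ (η' : ℝ≥0) (T : L1 ι →L[ℂ] ℂ) (y : ℝ),
      deriv (fun y : ℝ => T (phase deg θ (η + η') (q + y • v) a)) y
        = T (phaseGen hθ hη v (phase deg θ η' (q + y • v) a)) := fun η' T y => by
    have h := (T.restrictScalars ℝ).hasFDerivAt.comp_hasDerivAt y
      (hasDerivAt_phase_apply (η' := η') hθ hη q v (hasDerivAt_const y a))
    rw [map_zero, add_zero] at h
    exact h.deriv
  rw [iteratedDeriv_succ, iteratedDeriv_one, funext (hΛ (η + η') Λ)]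
  exact funext (hΛ η' (Λ.comp (phaseGen hθ hη v)))

variable (deg θ) in
/-- The vector field of the equation in the interaction picture, for the linear flow
`t ↦ phase deg θ 0 (t • e)`. -/
def interaction (e : Q) (F : L1 ι → L1 ι) (t : ℝ) (a : L1 ι) : L1 ι :=
  -Complex.I • phase deg θ 0 (-t • e) (F (phase deg θ 0 (t • e) a))

theorem continuous_interaction (hF : Continuous F) (e : Q) (a : L1 ι) :
    Continuous fun t => interaction deg θ e F t a := by
  have hflow : Continuous fun t : ℝ => phase deg θ 0 (t • e) a :=
    continuous_phase_apply_of_continuous (by fun_prop) continuous_const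
  exact (continuous_phase_apply_of_continuous (q := fun t : ℝ => -t • e) (by fun_prop)
    (hF.comp hflow)).const_smul (-Complex.I)

theorem norm_interaction_le (e : Q) (t : ℝ) (a : L1 ι) :
    ‖interaction deg θ e F t a‖ ≤ ‖F (phase deg θ 0 (t • e) a)‖ := by
  rw [interaction, norm_smul, norm_neg, Complex.norm_I, one_mul]
  exact norm_phase_apply_le _ _

theorem lipschitzOnWith_interaction {L R : ℝ≥0}
    (hF : LipschitzOnWith L F (Metric.closedBall 0 R)) (e : Q) (t : ℝ) :
    LipschitzOnWith L (interaction deg θ e F t) (Metric.closedBall 0 R) := by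
  refine LipschitzOnWith.of_dist_le_mul fun a ha b hb => ?_
  have hmem : ∀ {a : L1 ι}, a ∈ Metric.closedBall 0 (R : ℝ) →
      phase deg θ 0 (t • e) a ∈ Metric.closedBall 0 (R : ℝ) := fun ha =>
    mem_closedBall_zero_iff.2 ((norm_phase_apply_le _ _).trans (mem_closedBall_zero_iff.1 ha))
  rw [dist_eq_norm, dist_eq_norm, interaction, interaction, ← smul_sub, ← map_sub, norm_smul,
    norm_neg, Complex.norm_I, one_mul]
  calc _ ≤ _ := norm_phase_apply_le _ _
    _ ≤ L * ‖phase deg θ 0 (t • e) a - phase deg θ 0 (t • e) b‖ :=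
      hF.norm_sub_le (hmem ha) (hmem hb)
    _ ≤ L * ‖a - b‖ := by
      rw [← map_sub]
      gcongr
      exact norm_phase_apply_le _ _

theorem IsAdmissible.exists_interaction_solution (hF : IsAdmissible deg n F) :
    ∃ C : ℝ, 0 < C ∧ ∀ (θ : ι → Q →L[ℝ] ℝ) (e : Q) (x₀ : L1 ι) (ρ τ : ℝ), ‖x₀‖ ≤ ρ → 0 < τ →
      C * ρ ^ n * τ ≤ 1 → ∃ a : ℝ → L1 ι, a 0 = x₀ ∧
        (∀ t ∈ Set.Ioo (-τ) τ, HasDerivAt a (interaction deg θ e F t (a t)) t) ∧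
        ∀ t ∈ Set.Ico 0 τ, ‖a t - x₀ - ∫ u in (0 : ℝ)..t, interaction deg θ e F u x₀‖
          ≤ C * ρ ^ (2 * n + 1) * t ^ 2 := by
  obtain ⟨C, hC⟩ := hF.exists_lipschitzOnWith
  refine ⟨C * 2 ^ (n + 1) + C ^ 2 * 2 ^ (2 * n + 1) + 1, by positivity,
    fun θ e x₀ ρ τ hx₀ hτ hτρ => ?_⟩
  lift ρ to ℝ≥0 using (norm_nonneg _).trans hx₀
  have hball : Metric.closedBall x₀ (ρ : ℝ) ⊆ Metric.closedBall 0 ((2 * ρ : ℝ≥0) : ℝ) :=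
    Metric.closedBall_subset_closedBall' (by
      rw [dist_zero_right]
      push_cast
      linarith)
  have hbound : ∀ t, ∀ x ∈ Metric.closedBall x₀ (ρ : ℝ),
      ‖interaction deg θ e F t x‖ ≤ (C * (2 * ρ) ^ (n + 1) : ℝ≥0) := fun t x hx =>
    (norm_interaction_le e t x).trans (norm_le_of_lipschitzOnWith hF.map_zero (hC (2 * ρ))
      ((norm_phase_apply_le _ _).trans (mem_closedBall_zero_iff.1 (hball hx))))
  have hτC : C * 2 ^ (n + 1) * ρ ^ n * τ ≤ (1 : ℝ) := by
    refine le_trans ?_ hτρ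
    gcongr
    nlinarith [show (0 : ℝ) ≤ C ^ 2 * 2 ^ (2 * n + 1) by positivity]
  obtain ⟨a, ha0, ha, hdev⟩ := exists_ode_solution_near_first_picard_iterate hτ
    (continuous_interaction hF.contDiff.continuous e) hbound
    (fun t => (lipschitzOnWith_interaction (hC (2 * ρ)) e t).mono hball) (by
      calc ((C * (2 * ρ) ^ (n + 1) : ℝ≥0) : ℝ) * τ = C * 2 ^ (n + 1) * ρ ^ n * τ * ρ := by
            push_cast
            ring
        _ ≤ 1 * ρ := by gcongr
        _ = ρ := one_mul _)
  refine ⟨a, ha0, ha, fun t ht => (hdev t ht).trans ?_⟩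
  calc _ = (C ^ 2 * 2 ^ (2 * n + 1)) * (ρ : ℝ) ^ (2 * n + 1) * t ^ 2 := by
        push_cast
        ring
    _ ≤ _ := by
        gcongr
        linarith [show (0 : ℝ) ≤ C * 2 ^ (n + 1) by positivity]

theorem IsAdmissible.damping_interaction (hF : IsAdmissible deg n F) (e : Q) (t : ℝ) (a : L1 ι) :
    damping deg (η + (η' + η')) (interaction deg θ e F t a)
      = -Complex.I • phase deg θ η (-t • e) (F (phase deg θ η' (t • e) (damping deg η' a))) := by
  rw [phase_damping, ← add_zero (η' + η'), ← damping_phase, hF.map_damping, phase_damping,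
    interaction, map_smul, damping_phase, add_zero, add_zero]

theorem IsAdmissible.contDiffOn_damping (hF : IsAdmissible deg n F)
    (hθ : ∀ i, ‖θ i‖ ≤ C * ((deg i : ℝ) + 1) ^ 2) {e : Q} {J : Set ℝ} (hJ : IsOpen J)
    {a : ℝ → L1 ι} (ha : ∀ t ∈ J, HasDerivAt a (interaction deg θ e F t (a t)) t) (hη : 0 < η) :
    ContDiffOn ℝ ∞ (fun t => damping deg η (a t)) J := by
  have hderiv : ∀ η, ∀ t ∈ J, HasDerivAt (fun t => damping deg η (a t))
      (damping deg η (interaction deg θ e F t (a t))) t := fun η t ht =>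
    ((damping deg η).restrictScalars ℝ).hasFDerivAt.comp_hasDerivAt t (ha t ht)
  have hdiff : ∀ η, DifferentiableOn ℝ (fun t => damping deg η (a t)) J := fun η t ht =>
    (hderiv η t ht).differentiableAt.differentiableWithinAt
  rw [contDiffOn_infty]
  intro k
  -- The vector field with damping `η` is a smooth function of the solution with damping `η / 4`.
  induction k generalizing η with
  | zero => exact contDiffOn_zero.2 (hdiff η).continuousOn
  | succ k ih =>
    refine (contDiffOn_succ_iff_deriv_of_isOpen hJ).2 ⟨hdiff η,
      fun h => absurd h (WithTop.natCast_ne_top k), ?_⟩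
    have hquarter : 0 < η / 2 / 2 := half_pos (half_pos hη)
    have hη_split : η / 2 + (η / 2 / 2 + η / 2 / 2) = η := by rw [add_halves, add_halves]
    have hfield := (contDiffOn_phase_apply (k := (k : ℕ∞)) (q := fun t : ℝ => -t • e) hθ
      (half_pos hη) (by fun_prop) ((hF.contDiff.of_le (by exact_mod_cast le_top)).comp_contDiffOn
        (contDiffOn_phase_apply (k := (k : ℕ∞)) (q := fun t : ℝ => t • e) hθ hquarter
          (by fun_prop) (ih hquarter)))).const_smul (-Complex.I)
    refine hfield.congr fun t ht => ?_
    rw [(hderiv η t ht).deriv]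
    nth_rw 1 [← hη_split]
    exact hF.damping_interaction e t (a t)

end Flow

section Characters

variable {d : ℕ}

theorem character_apply (k : Fin d → ℤ) (x : Fin d → ℝ) :
    character k x = Complex.exp (Complex.I * (∑ j, (k j : ℝ) * x j : ℝ)) := rfl

theorem norm_character (k : Fin d → ℤ) (x : Fin d → ℝ) : ‖character k x‖ = 1 := by
  rw [character_apply, mul_comm, Complex.norm_exp_ofReal_mul_I]

theorem character_zero (x : Fin d → ℝ) : character 0 x = 1 := by
  simp [character_apply]

theorem character_add (k l : Fin d → ℤ) (x : Fin d → ℝ) :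
    character (k + l) x = character k x * character l x := by
  simp only [character_apply, ← Complex.exp_add, Pi.add_apply, Int.cast_add, add_mul, mul_add,
    Finset.sum_add_distrib, Complex.ofReal_add]

theorem character_neg (k : Fin d → ℤ) (x : Fin d → ℝ) :
    character (-k) x = (starRingEnd ℂ) (character k x) := by
  simp only [character_apply, ← Complex.exp_conj, map_mul, Complex.conj_I, Complex.conj_ofReal,
    Pi.neg_apply, Int.cast_neg, neg_mul, mul_neg, Finset.sum_neg_distrib, Complex.ofReal_neg]

theorem integral_Icc_exp (k : ℤ) :
    ∫ y in Set.Icc 0 (2 * Real.pi), Complex.exp (Complex.I * ((k : ℝ) * y : ℝ))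
      = if k = 0 then ((2 * Real.pi : ℝ) : ℂ) else 0 := by
  rw [MeasureTheory.integral_Icc_eq_integral_Ioc, ← intervalIntegral.integral_of_le
    (by positivity)]
  split_ifs with hk
  · simp [hk]
  · have hIk : Complex.I * (k : ℂ) ≠ 0 := mul_ne_zero Complex.I_ne_zero (by exact_mod_cast hk)
    have hperiod : Complex.exp (Complex.I * k * (2 * Real.pi : ℝ)) = 1 :=
      Complex.exp_eq_one_iff.2 ⟨k, by push_cast; ring⟩
    simp only [Complex.ofReal_mul (k : ℝ), ← mul_assoc, Complex.ofReal_intCast]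
    rw [integral_exp_mul_complex hIk, hperiod]
    simp

theorem integral_cell_character (k : Fin d → ℤ) :
    ∫ x in cell d, character k x = if k = 0 then ((2 * Real.pi : ℝ) : ℂ) ^ d else 0 := by
  have hcell : cell d = Set.univ.pi fun _ => Set.Icc 0 (2 * Real.pi) := by
    rw [Set.pi_univ_Icc]
    rfl
  simp only [character_apply, Complex.ofReal_sum, Finset.mul_sum, Complex.exp_sum]
  rw [hcell, MeasureTheory.volume_pi, MeasureTheory.Measure.restrict_pi_pi,
    MeasureTheory.integral_fintype_prod_eq_prod
      (fun j (y : ℝ) => Complex.exp (Complex.I * ((k j : ℝ) * y : ℝ)))]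
  simp only [integral_Icc_exp]
  split_ifs with hk
  · simp [hk]
  · obtain ⟨j, hj⟩ := Function.ne_iff.1 hk
    exact Finset.prod_eq_zero (Finset.mem_univ j) (if_neg hj)

theorem distFourierCoeff_toDistribution (f : SmoothTorus d) (k : Fin d → ℤ) :
    distFourierCoeff (toDistribution f) k
      = (((2 * Real.pi : ℝ) : ℂ) ^ d)⁻¹ * ∫ x in cell d, f x * character (-k) x := rfl

end Characters

section Index

variable {d : ℕ}

/-- The pairs of a degree `n` and a frequency `k` whose components are at most `n`. -/
def gradedFreq (d : ℕ) : AddSubmonoid (ℕ × (Fin d → ℤ)) where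
  carrier := {p | ∀ j, |p.2 j| ≤ p.1}
  add_mem' {p q} hp hq j := by
    simp only [Prod.snd_add, Prod.fst_add, Pi.add_apply, Nat.cast_add]
    exact (abs_add_le _ _).trans (add_le_add (hp j) (hq j))
  zero_mem' j := by simp

/-- The index monoid of the Wiener algebra. The degree is kept apart from the frequency because it
is not affected by the cancellation of frequencies: it counts the factors of a product. -/
abbrev Idx (d : ℕ) : Type := ↥(gradedFreq d)

/-- The degree of an index. -/
def Idx.deg (i : Idx d) : ℕ := i.1.1

/-- The frequency of an index. -/
def Idx.freq (i : Idx d) : Fin d → ℤ := i.1.2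

/-- The index with the opposite frequency. -/
def Idx.conj (i : Idx d) : Idx d := ⟨(i.1.1, -i.1.2), fun j => by simpa using i.2 j⟩

theorem Idx.deg_add (i j : Idx d) : (i + j).deg = i.deg + j.deg := rfl

theorem Idx.freq_add (i j : Idx d) : (i + j).freq = i.freq + j.freq := rfl

theorem Idx.deg_conj (i : Idx d) : i.conj.deg = i.deg := rfl

theorem Idx.freq_conj (i : Idx d) : i.conj.freq = -i.freq := rfl

/-- The phase `k · x - ½ |k|² t` of a plane wave of the free equation, as a function of `(t, x)`. -/
def planePhase (k : Fin d → ℤ) : ℝ × (Fin d → ℝ) →L[ℝ] ℝ :=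
  (-((∑ j, (k j : ℝ) ^ 2) / 2)) • ContinuousLinearMap.fst ℝ ℝ (Fin d → ℝ)
    + ∑ j, (k j : ℝ) • (ContinuousLinearMap.proj j).comp (ContinuousLinearMap.snd ℝ ℝ (Fin d → ℝ))

theorem planePhase_apply (k : Fin d → ℤ) (t : ℝ) (x : Fin d → ℝ) :
    planePhase k (t, x) = -((∑ j, (k j : ℝ) ^ 2) / 2) * t + ∑ j, (k j : ℝ) * x j := by
  simp [planePhase]

theorem norm_planePhase_le (k : Fin d → ℤ) : ‖planePhase k‖ ≤ 2 * ∑ j, (k j : ℝ) ^ 2 := by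
  refine ContinuousLinearMap.opNorm_le_bound _ (by positivity) fun q => ?_
  obtain ⟨t, x⟩ := q
  have ht : |t| ≤ ‖(t, x)‖ := norm_fst_le (t, x)
  have hx : ∀ j, |x j| ≤ ‖(t, x)‖ := fun j => (norm_le_pi_norm x j).trans (norm_snd_le (t, x))
  have hk : ∀ j, |(k j : ℝ)| ≤ (k j : ℝ) ^ 2 := fun j => by
    have h : |k j| ≤ k j ^ 2 := by
      rcases eq_or_ne (k j) 0 with h0 | h0
      · simp [h0]
      · rw [← sq_abs]
        exact le_self_pow₀ (Int.one_le_abs h0) two_ne_zero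
    exact_mod_cast h
  have htime : |(-((∑ j, (k j : ℝ) ^ 2) / 2)) * t| ≤ (∑ j, (k j : ℝ) ^ 2) * ‖(t, x)‖ := by
    rw [abs_mul, abs_neg, abs_of_nonneg (by positivity)]
    gcongr
    exact half_le_self (by positivity)
  have hspace : |∑ j, (k j : ℝ) * x j| ≤ (∑ j, (k j : ℝ) ^ 2) * ‖(t, x)‖ := by
    refine (Finset.abs_sum_le_sum_abs _ _).trans ?_
    rw [Finset.sum_mul]
    refine Finset.sum_le_sum fun j _ => ?_
    rw [abs_mul]
    gcongr
    exacts [hk j, hx j]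
  rw [planePhase_apply, Real.norm_eq_abs]
  linarith [abs_add_le (-((∑ j, (k j : ℝ) ^ 2) / 2) * t) (∑ j, (k j : ℝ) * x j)]

/-- The phases of the plane waves whose frequencies are dilated by `N`. -/
def scaledPhase (N : ℕ) (i : Idx d) : ℝ × (Fin d → ℝ) →L[ℝ] ℝ := planePhase (N • i.freq)

theorem norm_scaledPhase_le (N : ℕ) (i : Idx d) :
    ‖scaledPhase N i‖ ≤ 2 * d * N ^ 2 * ((i.deg : ℝ) + 1) ^ 2 := by
  have hfreq : ∀ j, ((i.freq j : ℤ) : ℝ) ^ 2 ≤ ((i.deg : ℝ) + 1) ^ 2 := fun j => by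
    have h : |(i.freq j : ℝ)| ≤ i.deg := by exact_mod_cast i.2 j
    rw [← sq_abs]
    gcongr
    linarith
  have hsum : ∑ j, (i.freq j : ℝ) ^ 2 ≤ d * ((i.deg : ℝ) + 1) ^ 2 :=
    (Finset.sum_le_card_nsmul _ _ _ fun j _ => hfreq j).trans (by simp)
  calc ‖scaledPhase N i‖ ≤ 2 * ∑ j, (((N • i.freq) j : ℤ) : ℝ) ^ 2 := norm_planePhase_le _
    _ = 2 * N ^ 2 * ∑ j, (i.freq j : ℝ) ^ 2 := by
      simp only [Pi.smul_apply, nsmul_eq_mul, Int.cast_mul, Int.cast_natCast, mul_pow,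
        ← Finset.mul_sum, mul_assoc]
    _ ≤ 2 * N ^ 2 * (d * ((i.deg : ℝ) + 1) ^ 2) := by gcongr
    _ = _ := by ring

/-- The evolution of the free equation on the Fourier side, with damping `η`. -/
abbrev freePhase (N : ℕ) (η : ℝ≥0) (q : ℝ × (Fin d → ℝ)) : L1 (Idx d) →L[ℂ] L1 (Idx d) :=
  phase Idx.deg (scaledPhase N) η q

end Index

section Field

variable {d : ℕ} (N : ℕ)

/-- The value at `x` of the function with the given coefficients. -/
def evalAt (x : Fin d → ℝ) : L1 (Idx d) →L[ℂ] ℂ := l1Lift fun i => character (N • i.freq) x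

theorem evalAt_apply (x : Fin d → ℝ) (a : L1 (Idx d)) :
    evalAt N x a = ∑' i, a i • character (N • i.freq) x :=
  l1Lift_apply (fun _ => (norm_character _ x).le) a

theorem evalAt_unitVec (x : Fin d → ℝ) (i : Idx d) :
    evalAt N x (unitVec i) = character (N • i.freq) x :=
  l1Lift_unitVec (fun _ => (norm_character _ x).le) i

theorem evalAt_conv (x : Fin d → ℝ) (a b : L1 (Idx d)) :
    evalAt N x (conv a b) = evalAt N x a * evalAt N x b :=
  l1Lift_conv (fun _ => (norm_character _ x).le)
    (fun i j => by rw [Idx.freq_add, smul_add, character_add]) a b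

theorem evalAt_conjMap (x : Fin d → ℝ) (a : L1 (Idx d)) :
    evalAt N x (conjMap Idx.conj a) = (starRingEnd ℂ) (evalAt N x a) :=
  l1Lift_conjMap (fun _ => (norm_character _ x).le)
    (fun i => by rw [Idx.freq_conj, smul_neg, character_neg]) a

theorem evalAt_zero_freePhase (η : ℝ≥0) (t : ℝ) (x : Fin d → ℝ) (a : L1 (Idx d)) :
    evalAt N 0 (freePhase N η (t, x) a) = evalAt N x (freePhase N η (t, 0) a) := by
  have h : (evalAt N 0).comp (freePhase (d := d) N η (t, x))
      = (evalAt N x).comp (freePhase N η (t, 0)) := by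
    refine L1.clm_ext fun i => ?_
    have hsymbol := phaseSymbol_add (deg := Idx.deg) (θ := scaledPhase N) (η := η) (η' := 0)
      ((t, 0) : ℝ × (Fin d → ℝ)) (0, x) i
    rw [Prod.mk_add_mk, add_zero, add_zero, zero_add] at hsymbol
    rw [ContinuousLinearMap.comp_apply, ContinuousLinearMap.comp_apply, phase_unitVec,
      phase_unitVec, map_smul, map_smul, evalAt_unitVec, evalAt_unitVec, hsymbol]
    simp [phaseSymbol, scaledPhase, planePhase_apply, character_apply]
  exact DFunLike.congr_fun h a

theorem evalAt_add_single (x : Fin d → ℝ) (l : Fin d) :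
    evalAt N (x + Pi.single l (2 * Real.pi)) = evalAt N x :=
  L1.clm_ext fun i => by
    rw [evalAt_unitVec, evalAt_unitVec]
    exact (character (N • i.freq)).2.2 x l

theorem contDiff_evalAt_damping {η : ℝ≥0} (hη : 0 < η) (b : L1 (Idx d)) :
    ContDiff ℝ ∞ fun x => evalAt N x (damping Idx.deg η b) := by
  have h : (fun x => evalAt N x (damping Idx.deg η b))
      = fun x => evalAt N 0 (freePhase N η (0, x) b) := funext fun x => by
    rw [evalAt_zero_freePhase, Prod.mk_zero_zero, freePhase, phase_zero_right]
  rw [h]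
  exact ((evalAt N 0).restrictScalars ℝ).contDiff.comp (contDiffOn_univ.1
    (contDiffOn_phase_apply (k := ⊤) (q := fun x : Fin d → ℝ => ((0 : ℝ), x))
      (norm_scaledPhase_le N) hη (by fun_prop) contDiffOn_const))

/-- The function on the torus with the coefficients `e^{-deg i} bᵢ`; the damping makes it smooth. -/
def synth (b : L1 (Idx d)) : SmoothTorus d :=
  ⟨fun x => evalAt N x (damping Idx.deg 1 b), contDiff_evalAt_damping N one_pos b,
    fun x l => by beta_reduce; rw [evalAt_add_single]⟩

theorem synth_apply (b : L1 (Idx d)) (x : Fin d → ℝ) :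
    synth N b x = evalAt N x (damping Idx.deg 1 b) := rfl

/-- The field with the coefficients `a t` in the interaction picture, up to the factors
`e^{-4 deg i}`. Of this damping, one unit makes `a` smooth in `t`, and the other three pay for the
smoothness of the phases and two of their derivatives. -/
def field (a : ℝ → L1 (Idx d)) (t : ℝ) : SmoothTorus d := synth N (freePhase N 3 (t, 0) (a t))

theorem field_apply (a : ℝ → L1 (Idx d)) (t : ℝ) (x : Fin d → ℝ) :
    field N a t x
      = evalAt N 0 (freePhase N (1 + (1 + 1)) (t, x) (damping Idx.deg 1 (a t))) := by
  rw [field, synth_apply, evalAt_zero_freePhase, phase_damping, damping_phase]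
  norm_num

variable {N}

theorem contDiffOn_field {a : ℝ → L1 (Idx d)} {J : Set ℝ}
    (ha : ContDiffOn ℝ ∞ (fun t => damping Idx.deg 1 (a t)) J) :
    ContDiffOn ℝ ∞ (fun q : ℝ × (Fin d → ℝ) => field N a q.1 q.2) (J ×ˢ Set.univ) := by
  have h := ((evalAt N 0).restrictScalars ℝ).contDiff.comp_contDiffOn (n := ∞)
    (contDiffOn_phase_apply (k := ⊤) (η := 1 + (1 + 1)) (norm_scaledPhase_le (d := d) N)
      (by positivity) contDiffOn_id
      (ha.comp (s := J ×ˢ Set.univ) contDiff_fst.contDiffOn fun q hq => hq.1))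
  exact h.congr fun q _ => field_apply N a q.1 q.2

/-- The generator of the free evolution in the direction `v`. -/
abbrev freeGen (N : ℕ) (v : ℝ × (Fin d → ℝ)) : L1 (Idx d) →L[ℂ] L1 (Idx d) :=
  phaseGen (norm_scaledPhase_le N) one_pos v

theorem hasDerivAt_field {a : ℝ → L1 (Idx d)} {t : ℝ} {a' : L1 (Idx d)}
    (ha : HasDerivAt a a' t) (x : Fin d → ℝ) :
    HasDerivAt (fun τ => field N a τ x)
      (evalAt N 0 (freeGen N (1, 0) (freePhase N (1 + 1) (t, x) (damping Idx.deg 1 (a t))))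
        + evalAt N 0 (freePhase N (1 + (1 + 1)) (t, x) (damping Idx.deg 1 a'))) t := by
  have hdamping : HasDerivAt (fun τ => damping Idx.deg 1 (a τ)) (damping Idx.deg 1 a') t :=
    ((damping Idx.deg 1).restrictScalars ℝ).hasFDerivAt.comp_hasDerivAt t ha
  have hline : ∀ τ : ℝ, ((0, x) : ℝ × (Fin d → ℝ)) + τ • (1, 0) = (τ, x) := fun τ => by simp
  have h := ((evalAt N 0).restrictScalars ℝ).hasFDerivAt.comp_hasDerivAt t
    (hasDerivAt_phase_apply (η' := 1 + 1) (norm_scaledPhase_le N) one_pos (0, x) (1, 0) hdamping)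
  simp only [hline, map_add] at h
  exact h.congr_of_eventuallyEq (.of_forall fun τ => field_apply N a τ x)

theorem iteratedDeriv_field (a : ℝ → L1 (Idx d)) (t : ℝ) (x : Fin d → ℝ) (l : Fin d) :
    iteratedDeriv 2 (fun y : ℝ => field N a t (Function.update x l y)) (x l)
      = evalAt N 0 (freeGen N (0, Pi.single l 1) (freeGen N (0, Pi.single l 1)
        (freePhase N 1 (t, x) (damping Idx.deg 1 (a t))))) := by
  have hline : ∀ y : ℝ, ((t, Function.update x l y) : ℝ × (Fin d → ℝ))
      = (t, Function.update x l 0) + y • (0, Pi.single l 1) := fun y => by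
    rw [Prod.smul_mk, Prod.mk_add_mk, smul_zero, add_zero, ← Pi.single_smul', smul_eq_mul, mul_one]
    refine congrArg _ (funext fun j => ?_)
    by_cases hj : j = l
    · subst hj
      simp
    · simp [hj]
  have hfield : (fun y : ℝ => field N a t (Function.update x l y)) = fun y =>
      evalAt N 0 (freePhase N (1 + (1 + 1)) ((t, Function.update x l 0) + y • (0, Pi.single l 1))
        (damping Idx.deg 1 (a t))) := funext fun y => by rw [field_apply, hline]
  have hx : (t, Function.update x l 0) + x l • (0, Pi.single l 1) = (t, x) := by
    rw [← hline, Function.update_eq_self]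
  rw [hfield, iteratedDeriv_two_phase_apply (norm_scaledPhase_le N) one_pos]
  beta_reduce
  rw [hx]

theorem schrodinger_freeGen (q : ℝ × (Fin d → ℝ)) (b : L1 (Idx d)) :
    Complex.I • freeGen N (1, 0) (freePhase N (1 + 1) q b)
      + (1 / 2 : ℂ) • ∑ l, freeGen N (0, Pi.single l 1) (freeGen N (0, Pi.single l 1)
        (freePhase N 1 q b)) = 0 := by
  have h : Complex.I • (freeGen N (1, 0)).comp (freePhase N (1 + 1) q)
      + (1 / 2 : ℂ) • ∑ l, (freeGen N (0, Pi.single l 1)).comp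
        ((freeGen N (0, Pi.single l 1)).comp (freePhase N 1 q)) = 0 := by
    refine L1.clm_ext fun i => ?_
    have htime : scaledPhase N i (1, 0) = -((∑ l, (((N • i.freq) l : ℤ) : ℝ) ^ 2) / 2) := by
      simp [scaledPhase, planePhase_apply]
    have hspace : ∀ l, scaledPhase N i (0, Pi.single l 1) = ((N • i.freq) l : ℤ) := fun l => by
      simp [scaledPhase, planePhase_apply, Pi.single_apply]
    simp only [add_apply, smul_apply, sum_apply, zero_apply, ContinuousLinearMap.comp_apply,
      phaseGen_phase_unitVec, map_smul, htime, hspace]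
    rw [smul_smul]
    simp only [smul_smul, ← Finset.sum_smul]
    rw [← add_smul]
    convert zero_smul ℂ _ using 2
    push_cast
    simp only [mul_mul_mul_comm Complex.I, ← Finset.mul_sum, ← sq]
    ring
  simpa only [add_apply, smul_apply, sum_apply, ContinuousLinearMap.comp_apply, zero_apply]
    using DFunLike.congr_fun h b

theorem evalAt_freePhase_interaction {n : ℕ} {F : L1 (Idx d) → L1 (Idx d)}
    (hF : IsAdmissible Idx.deg n F) (t : ℝ) (x : Fin d → ℝ) (a : L1 (Idx d)) :
    Complex.I * evalAt N 0 (freePhase N (1 + (1 + 1)) (t, x)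
        (damping Idx.deg 1 (interaction Idx.deg (scaledPhase N) (1, 0) F t a)))
      = evalAt N x (F (damping Idx.deg 1 (freePhase N 3 (t, 0) a))) := by
  have hte : t • ((1, 0) : ℝ × (Fin d → ℝ)) = (t, 0) := by simp
  have hte' : -t • ((1, 0) : ℝ × (Fin d → ℝ)) = -(t, 0) := by simp
  rw [evalAt_zero_freePhase, phase_damping, interaction, hte, hte', map_smul, map_smul, phase_phase,
    add_neg_cancel, phase_zero_right, ← hF.map_damping, damping_phase, damping_phase, smul_eq_mul,
    ← mul_assoc, mul_neg, Complex.I_mul_I, neg_neg, one_mul]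
  norm_num

theorem isSmoothSolution_field {n : ℕ} {F : L1 (Idx d) → L1 (Idx d)}
    (hF : IsAdmissible Idx.deg n F) {Φ : SmoothTorus d → (Fin d → ℝ) → ℂ}
    (hΦ : ∀ b x, Φ (synth N b) x = evalAt N x (F (damping Idx.deg 1 b))) {τ : ℝ} (hτ : 0 < τ)
    {a : ℝ → L1 (Idx d)} (ha : ∀ t ∈ Set.Ioo (-τ) τ, HasDerivAt a
      (interaction Idx.deg (scaledPhase N) (1, 0) F t (a t)) t) :
    IsSmoothSolution Φ (Set.Ioo (-τ) τ) (field N a) where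
  isOpen := isOpen_Ioo
  ordConnected := Set.ordConnected_Ioo
  zero_mem := ⟨neg_neg_of_pos hτ, hτ⟩
  contDiffOn :=
    contDiffOn_field (hF.contDiffOn_damping (norm_scaledPhase_le N) isOpen_Ioo ha one_pos)
  equation t ht x := by
    have hfree := congrArg (evalAt N 0)
      (schrodinger_freeGen (N := N) (t, x) (damping Idx.deg 1 (a t)))
    simp only [map_add, map_smul, map_sum, map_zero, smul_eq_mul] at hfree
    rw [(hasDerivAt_field (ha t ht) x).deriv, torusLaplacian,
      Finset.sum_congr rfl fun l _ => iteratedDeriv_field a t x l, mul_add,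
      evalAt_freePhase_interaction hF, field, hΦ, add_right_comm, hfree, zero_add]

end Field

section Coefficients

variable {d : ℕ}

/-- The indicator of the zero frequency. -/
def zeroInd (i : Idx d) : ℂ := if i.freq = 0 then 1 else 0

theorem norm_zeroInd_le (i : Idx d) : ‖zeroInd i‖ ≤ 1 := by
  rw [zeroInd]
  split_ifs <;> simp

/-- The mean of the function with the given coefficients. -/
def zeroMode : L1 (Idx d) →L[ℂ] ℂ := l1Lift zeroInd

theorem zeroMode_unitVec (i : Idx d) : zeroMode (unitVec i) = zeroInd i :=
  l1Lift_unitVec norm_zeroInd_le i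

theorem norm_zeroMode_le : ‖(zeroMode : L1 (Idx d) →L[ℂ] ℂ)‖ ≤ 1 :=
  norm_l1Lift_le zero_le_one norm_zeroInd_le

theorem zeroMode_freePhase (N : ℕ) (η : ℝ≥0) (t : ℝ) (a : L1 (Idx d)) :
    zeroMode (freePhase N η (t, 0) a) = zeroMode (damping Idx.deg η a) := by
  have h : (zeroMode (d := d)).comp (freePhase N η (t, 0))
      = zeroMode.comp (damping Idx.deg η) := by
    refine L1.clm_ext fun i => ?_
    rw [ContinuousLinearMap.comp_apply, ContinuousLinearMap.comp_apply, phase_unitVec,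
      damping_unitVec, map_smul, map_smul, zeroMode_unitVec, zeroInd]
    split_ifs with h0
    · simp [phaseSymbol, scaledPhase, planePhase_apply, h0]
    · simp
  exact DFunLike.congr_fun h a

theorem evalAt_diag_zeroInd (N : ℕ) (x : Fin d → ℝ) (w : L1 (Idx d)) :
    evalAt N x (diag zeroInd w) = zeroMode w := by
  have h : (evalAt N x).comp (diag zeroInd) = (zeroMode : L1 (Idx d) →L[ℂ] ℂ) := by
    refine L1.clm_ext fun i => ?_
    rw [ContinuousLinearMap.comp_apply, diag_unitVec norm_zeroInd_le, map_smul, zeroMode_unitVec,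
      evalAt_unitVec, zeroInd]
    split_ifs with h0
    · rw [h0, smul_zero, character_zero, one_smul]
    · rw [zero_smul]
  exact DFunLike.congr_fun h w

variable {N : ℕ}

theorem integral_cell_character_smul_freq (hN : N ≠ 0) (i : Idx d) :
    ∫ x in cell d, character (N • i.freq) x = ((2 * Real.pi : ℝ) : ℂ) ^ d * zeroInd i := by
  rw [integral_cell_character, zeroInd, mul_ite, mul_one, mul_zero]
  simp only [smul_eq_zero, hN, false_or]

theorem integral_evalAt (hN : N ≠ 0) (w : L1 (Idx d)) :
    ∫ x in cell d, evalAt N x w = ((2 * Real.pi : ℝ) : ℂ) ^ d * zeroMode w := by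
  have hint : ∀ i, MeasureTheory.IntegrableOn (fun x => w i • character (N • i.freq) x) (cell d) :=
    fun i => (integrableOn_cell (character (N • i.freq)).2.1.continuous).smul (w i)
  have hnorm : ∀ i x, ‖w i • character (N • i.freq) x‖ = ‖w i‖ := fun i x => by
    rw [norm_smul, norm_character, mul_one]
  have hsum : Summable fun i => ∫ x in cell d, ‖w i • character (N • i.freq) x‖ := by
    simp only [hnorm, MeasureTheory.integral_const]
    exact w.summable_norm.const_smul _
  simp only [evalAt_apply]
  rw [← MeasureTheory.integral_tsum_of_summable_integral_norm hint hsum, zeroMode,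
    l1Lift_apply norm_zeroInd_le, ← tsum_mul_left]
  refine tsum_congr fun i => ?_
  rw [MeasureTheory.integral_smul, integral_cell_character_smul_freq hN, smul_eq_mul, smul_eq_mul,
    mul_left_comm]

theorem two_pi_pow_ne_zero (d : ℕ) : ((2 * Real.pi : ℝ) : ℂ) ^ d ≠ 0 :=
  pow_ne_zero _ (Complex.ofReal_ne_zero.2 Real.two_pi_pos.ne')

theorem distFourierCoeff_synth_zero (hN : N ≠ 0) (b : L1 (Idx d)) :
    distFourierCoeff (toDistribution (synth N b)) 0 = zeroMode (damping Idx.deg 1 b) := by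
  simp only [distFourierCoeff_toDistribution, neg_zero, character_zero, mul_one, synth_apply]
  rw [integral_evalAt hN, inv_mul_cancel_left₀ (two_pi_pow_ne_zero d)]

theorem distFourierCoeff_field_zero (hN : N ≠ 0) (a : ℝ → L1 (Idx d)) (t : ℝ) :
    distFourierCoeff (toDistribution (field N a t)) 0 = zeroMode (damping Idx.deg 4 (a t)) := by
  rw [field, distFourierCoeff_synth_zero hN, damping_phase, zeroMode_freePhase]
  norm_num

theorem evalAt_oddPower (N : ℕ) (x : Fin d → ℝ) (n : ℕ) (u : L1 (Idx d)) :
    evalAt N x (oddPower Idx.conj n u) = ((‖evalAt N x u‖ ^ (2 * n) : ℝ) : ℂ) * evalAt N x u := by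
  induction n with
  | zero => simp [oddPower]
  | succ n ih =>
    rw [oddPower, evalAt_conv, evalAt_conv, evalAt_conjMap, ih, ← mul_assoc, Complex.mul_conj,
      Complex.normSq_eq_norm_sq, ← mul_assoc, ← Complex.ofReal_mul, ← pow_add, mul_add_one,
      add_comm 2]

theorem nlsTerm_synth (N σ : ℕ) (μ : ℝ) (b : L1 (Idx d)) (x : Fin d → ℝ) :
    nlsTerm μ σ (synth N b) x
      = evalAt N x ((μ : ℂ) • oddPower Idx.conj σ (damping Idx.deg 1 b)) := by
  rw [map_smul, evalAt_oddPower, nlsTerm, synth_apply, smul_eq_mul, mul_assoc]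

/-- The renormalized cubic nonlinearity on the Fourier side. -/
def renormalizedPower (u : L1 (Idx d)) : L1 (Idx d) :=
  oddPower Idx.conj 1 u + (-2 : ℂ) • massTerm Idx.conj zeroInd u

theorem renormalizedPower_isAdmissible : IsAdmissible Idx.deg 2 (renormalizedPower (d := d)) :=
  (oddPower_isAdmissible Idx.deg_add Idx.deg_conj 1).add
    ((massTerm_isAdmissible Idx.deg_add Idx.deg_conj norm_zeroInd_le).smul (-2 : ℂ))

theorem integral_norm_sq_synth (hN : N ≠ 0) (b : L1 (Idx d)) :
    ((∫ y in cell d, ‖synth N b y‖ ^ 2 : ℝ) : ℂ) = ((2 * Real.pi : ℝ) : ℂ) ^ d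
      * zeroMode (conv (damping Idx.deg 1 b) (conjMap Idx.conj (damping Idx.deg 1 b))) := by
  rw [← integral_evalAt hN, ← integral_complex_ofReal]
  simp only [evalAt_conv, evalAt_conjMap, Complex.mul_conj, Complex.normSq_eq_norm_sq, synth_apply]

theorem renormalizedTerm_synth (hN : N ≠ 0) (μ : ℝ) (b : L1 (Idx d)) (x : Fin d → ℝ) :
    renormalizedTerm μ (synth N b) x
      = evalAt N x ((μ : ℂ) • renormalizedPower (damping Idx.deg 1 b)) := by
  have hpi := two_pi_pow_ne_zero d
  rw [renormalizedTerm, Complex.ofReal_mul, integral_norm_sq_synth hN, renormalizedPower, map_smul,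
    map_add, map_smul, evalAt_oddPower, massTerm, evalAt_conv, evalAt_diag_zeroInd, synth_apply]
  push_cast at hpi ⊢
  simp only [smul_eq_mul]
  field_simp
  ring

end Coefficients

section Tuples

variable {J : Type}

/-- The index set of the expansion of `|u|^{2n} u` when `u` is a sum over `J`. -/
def Tup (J : Type) : ℕ → Type
  | 0 => J
  | n + 1 => J × J × Tup J n

instance instFintypeTup (J : Type) [Fintype J] : ∀ n, Fintype (Tup J n)
  | 0 => inferInstanceAs (Fintype J)
  | n + 1 =>
    letI := instFintypeTup J n
    inferInstanceAs (Fintype (J × J × Tup J n))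

/-- The alternating sum `w j₁ + τ (w j₂) + w j₃ + ⋯` over a tuple. -/
def Tup.alt {G : Type*} [Add G] (τ : G → G) (w : J → G) : ∀ n, Tup J n → G
  | 0, j => w j
  | n + 1, (j, j', l) => w j + (τ (w j') + Tup.alt τ w n l)

theorem Tup.map_alt {G H : Type*} [Add G] [Add H] {τ : G → G} {τ' : H → H} {f : G → H}
    (hadd : ∀ a b, f (a + b) = f a + f b) (hf : ∀ a, f (τ a) = τ' (f a)) (w : J → G) (n : ℕ)
    (l : Tup J n) : f (Tup.alt τ w n l) = Tup.alt τ' (fun j => f (w j)) n l := by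
  induction n with
  | zero => rfl
  | succ n ih =>
    obtain ⟨j, j', l⟩ := l
    rw [Tup.alt, Tup.alt, hadd, hadd, hf, ih]

/-- The coefficient of a tuple in the expansion of `|u|^{2n} u` for a sum `u` with terms `zⱼ`. -/
def Tup.monomial (z : J → ℂ) : ∀ n, Tup J n → ℂ
  | 0, j => z j
  | n + 1, (j, j', l) => z j * ((starRingEnd ℂ) (z j') * Tup.monomial z n l)

theorem Tup.monomial_mul_cexp (A : ℝ) (θ : J → ℝ) (n : ℕ) (l : Tup J n) :
    Tup.monomial (fun j => (A : ℂ) * Complex.exp (Complex.I * (θ j : ℝ))) n l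
      = (A : ℂ) ^ (2 * n + 1) * Complex.exp (Complex.I * (Tup.alt Neg.neg θ n l : ℝ)) := by
  induction n with
  | zero => rw [mul_zero, zero_add, pow_one]; rfl
  | succ n ih =>
    obtain ⟨j, j', l⟩ := l
    simp only [Tup.monomial, Tup.alt, ih, map_mul, ← Complex.exp_conj, Complex.conj_I,
      Complex.conj_ofReal, Complex.ofReal_add, Complex.ofReal_neg, mul_add, Complex.exp_add,
      neg_mul, mul_neg]
    ring

variable [Fintype J]

theorem Tup.sum_succ {G : Type*} [AddCommMonoid G] (n : ℕ) (f : Tup J (n + 1) → G) :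
    ∑ l, f l = ∑ j, ∑ j', ∑ l : Tup J n, f (j, j', l) :=
  (Fintype.sum_prod_type (α₁ := J) (α₂ := J × Tup J n) f).trans
    (Finset.sum_congr rfl fun _ _ => Fintype.sum_prod_type _)

theorem oddPower_sum_smul_unitVec {ι : Type*} [DecidableEq ι] [Add ι] (τ : ι → ι) (z : J → ℂ)
    (e : J → ι) (n : ℕ) :
    oddPower τ n (∑ j, z j • unitVec (e j))
      = ∑ l, Tup.monomial z n l • unitVec (Tup.alt τ e n l) := by
  induction n with
  | zero => rfl
  | succ n ih =>
    rw [oddPower, ih, Tup.sum_succ]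
    simp only [map_sum, conjMap_smul_unitVec, sum_apply, map_smul,
      smul_apply, conv_unitVec, Finset.smul_sum, smul_smul]
    rw [Finset.sum_comm, Finset.sum_congr rfl fun _ _ => Finset.sum_comm, Finset.sum_comm]
    refine Finset.sum_congr rfl fun j _ => Finset.sum_congr rfl fun j' _ =>
      Finset.sum_congr rfl fun l _ => ?_
    rw [Tup.monomial, Tup.alt]
    congr 1
    ring

end Tuples

section PlaneWaveData

variable {d K N σ : ℕ} {J : Type} {k : J → Fin d → ℤ}

/-- The index of degree `K` with frequency `k`. -/
def waveIdx {k : Fin d → ℤ} (hk : ∀ i, |k i| ≤ K) : Idx d := ⟨(K, k), hk⟩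

/-- The signed sum of the squared frequencies of a tuple, by which the phase of its contribution to
the nonlinearity differs from that of the free equation. -/
def resonance (k : J → Fin d → ℤ) (σ : ℕ) (l : Tup J σ) : ℤ :=
  Tup.alt Neg.neg (fun j => ∑ i, k j i ^ 2) σ l

theorem alt_planePhase (N : ℕ) (t : ℝ) (l : Tup J σ) :
    Tup.alt Neg.neg (fun j => planePhase (N • k j) (t, 0)) σ l
      = -((N : ℝ) ^ 2 / 2 * resonance k σ l * t) := by
  rw [resonance, Tup.map_alt (f := fun m : ℤ => -((N : ℝ) ^ 2 / 2 * m * t)) (τ' := Neg.neg)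
    (fun a b => by push_cast; ring) (fun a => by push_cast; ring)]
  congr 1
  funext j
  simp only [planePhase_apply, nsmul_eq_mul, Pi.mul_apply, Pi.natCast_apply, Int.cast_mul,
    Int.cast_natCast, mul_pow, ← Finset.mul_sum, Pi.zero_apply, mul_zero, Finset.sum_const_zero,
    add_zero, Int.cast_sum, Int.cast_pow]
  ring

variable [Fintype J]

/-- The coefficients of `A ∑ⱼ e^{i kⱼ · x}`, up to the damping. -/
def dataVec (hk : ∀ j i, |k j i| ≤ K) (A : ℝ) : L1 (Idx d) :=
  ∑ j, (A : ℂ) • unitVec (waveIdx (hk j))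

variable (hk : ∀ j i, |k j i| ≤ K)

theorem norm_dataVec_le {A : ℝ} (hA : 0 ≤ A) : ‖dataVec hk A‖ ≤ Fintype.card J * A := by
  refine (norm_sum_le_of_le _ fun j _ => ?_).trans_eq
    (by rw [Finset.sum_const, Finset.card_univ, nsmul_eq_mul])
  rw [norm_smul, norm_unitVec, mul_one, Complex.norm_real, Real.norm_of_nonneg hA]

theorem damping_dataVec (η : ℝ≥0) (A : ℝ) :
    damping Idx.deg η (dataVec hk A) = dataVec hk (Real.exp (-(η * K)) * A) := by
  simp only [dataVec, map_sum, map_smul, damping_unitVec, smul_smul, Complex.ofReal_mul, mul_comm]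
  rfl

theorem freePhase_dataVec (q : ℝ × (Fin d → ℝ)) (A : ℝ) :
    freePhase N 0 q (dataVec hk A)
      = ∑ j, ((A : ℂ) * Complex.exp (Complex.I * (planePhase (N • k j) q : ℝ))) •
        unitVec (waveIdx (hk j)) := by
  simp only [dataVec, map_sum, map_smul, phase_unitVec, smul_smul, phaseSymbol, NNReal.coe_zero,
    zero_mul, neg_zero, Complex.ofReal_zero, zero_add]
  rfl

theorem zeroMode_freePhase_dataVec (hk0 : ∀ j, k j ≠ 0) (q : ℝ × (Fin d → ℝ)) (A : ℝ) :
    zeroMode (freePhase N 0 q (dataVec hk A)) = 0 := by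
  rw [freePhase_dataVec, map_sum]
  refine Finset.sum_eq_zero fun j _ => ?_
  rw [map_smul, zeroMode_unitVec, zeroInd,
    if_neg (show (waveIdx (hk j)).freq ≠ 0 from hk0 j), smul_zero]

theorem evalAt_zero_freePhase_dataVec (x : Fin d → ℝ) (A : ℝ) :
    evalAt N 0 (freePhase N 0 (0, x) (dataVec hk A)) = ∑ j, (A : ℂ) * character (N • k j) x := by
  rw [evalAt_zero_freePhase, Prod.mk_zero_zero, freePhase, phase_zero_zero]
  simp only [one_apply_eq_self, dataVec, map_sum, map_smul, evalAt_unitVec,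
    smul_eq_mul]
  rfl

/-- The sum of the phase factors of the tuples with total frequency zero, which drives the zero
mode. -/
def phaseSum (k : J → Fin d → ℤ) (σ N : ℕ) (t : ℝ) : ℂ :=
  ∑ l : Tup J σ with Tup.alt Neg.neg k σ l = 0,
    Complex.exp (-Complex.I * ((N : ℝ) ^ 2 / 2 * resonance k σ l * t : ℝ))

theorem zeroMode_oddPower_freePhase_dataVec (A t : ℝ) :
    zeroMode (oddPower Idx.conj σ (freePhase N 0 (t, 0) (dataVec hk A)))
      = (A : ℂ) ^ (2 * σ + 1) * phaseSum k σ N t := by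
  rw [freePhase_dataVec, oddPower_sum_smul_unitVec, map_sum, phaseSum, Finset.sum_filter,
    Finset.mul_sum]
  refine Finset.sum_congr rfl fun l _ => ?_
  have hfreq : (Tup.alt Idx.conj (fun j => waveIdx (hk j)) σ l).freq = Tup.alt Neg.neg k σ l :=
    Tup.map_alt Idx.freq_add Idx.freq_conj _ σ l
  rw [map_smul, zeroMode_unitVec, zeroInd, hfreq, Tup.monomial_mul_cexp, alt_planePhase,
    smul_eq_mul, mul_ite, mul_one, mul_zero, mul_ite, mul_zero, Complex.ofReal_neg, mul_neg,
    neg_mul]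

end PlaneWaveData

section Solution

variable {d σ N : ℕ} {μ : ℂ} {F : L1 (Idx d) → L1 (Idx d)} {Φ : SmoothTorus d → (Fin d → ℝ) → ℂ}

/-- The nonlinearity `Φ` is given by the map `F` on the Fourier side, and its effect on the zero
mode of a function of mean zero is that of `μ |ψ|^{2σ} ψ`. -/
structure IsPowerLike (Φ : SmoothTorus d → (Fin d → ℝ) → ℂ) (F : L1 (Idx d) → L1 (Idx d)) (σ : ℕ)
    (μ : ℂ) : Prop where
  isAdmissible : IsAdmissible Idx.deg (2 * σ) F
  apply_synth : ∀ {N : ℕ}, N ≠ 0 → ∀ b x, Φ (synth N b) x = evalAt N x (F (damping Idx.deg 1 b))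
  zeroMode_apply : ∀ {v}, zeroMode v = 0 → zeroMode (F v) = μ * zeroMode (oddPower Idx.conj σ v)

theorem isPowerLike_nlsTerm (d σ : ℕ) (μ : ℝ) :
    IsPowerLike (d := d) (nlsTerm μ σ) (fun u => (μ : ℂ) • oddPower Idx.conj σ u) σ μ where
  isAdmissible := (oddPower_isAdmissible Idx.deg_add Idx.deg_conj σ).smul (μ : ℂ)
  apply_synth _ := nlsTerm_synth _ σ μ
  zeroMode_apply _ := map_smul _ _ _

theorem zeroMode_conv_diag_zeroInd (w v : L1 (Idx d)) :
    zeroMode (conv (diag zeroInd w) v) = zeroMode w * zeroMode v := by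
  have h : (ContinuousLinearMap.compL ℂ (L1 (Idx d)) (L1 (Idx d)) ℂ zeroMode).comp
      (conv.comp (diag zeroInd))
      = (ContinuousLinearMap.mul ℂ ℂ).bilinearComp zeroMode zeroMode := by
    refine L1.bilin_ext fun i j => ?_
    change zeroMode (conv (diag zeroInd (unitVec i)) (unitVec j))
      = zeroMode (unitVec i) * zeroMode (unitVec j)
    rw [diag_unitVec norm_zeroInd_le, map_smul, smul_apply, conv_unitVec, map_smul,
      zeroMode_unitVec, zeroMode_unitVec, zeroMode_unitVec, smul_eq_mul]
    simp only [zeroInd, Idx.freq_add]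
    split_ifs <;> simp_all
  exact DFunLike.congr_fun (DFunLike.congr_fun h w) v

theorem zeroMode_renormalizedPower {v : L1 (Idx d)} (hv : zeroMode v = 0) :
    zeroMode (renormalizedPower v) = zeroMode (oddPower Idx.conj 1 v) := by
  rw [renormalizedPower, map_add, map_smul, massTerm, zeroMode_conv_diag_zeroInd, hv, mul_zero,
    smul_zero, add_zero]

theorem isPowerLike_renormalizedTerm (d : ℕ) (μ : ℝ) :
    IsPowerLike (d := d) (renormalizedTerm μ) (fun u => (μ : ℂ) • renormalizedPower u) 1 μ where
  isAdmissible := renormalizedPower_isAdmissible.smul (μ : ℂ)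
  apply_synth hN := renormalizedTerm_synth hN μ
  zeroMode_apply hv := by rw [map_smul, smul_eq_mul, zeroMode_renormalizedPower hv]

variable {K : ℕ} {J : Type} [Fintype J] {k : J → Fin d → ℤ}

theorem field_zero_apply (hk : ∀ j i, |k j i| ≤ K) {A : ℝ} {a : ℝ → L1 (Idx d)}
    (ha : damping Idx.deg 4 (a 0) = dataVec hk A) (x : Fin d → ℝ) :
    field N a 0 x = ∑ j, (A : ℂ) * character (N • k j) x := by
  rw [field_apply, phase_damping, show (1 + (1 + 1) + 1 : ℝ≥0) = 0 + 4 by norm_num,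
    ← phase_damping, ha, evalAt_zero_freePhase_dataVec]

theorem IsPowerLike.zeroMode_damping_interaction (hΦ : IsPowerLike Φ F σ μ)
    (hk : ∀ j i, |k j i| ≤ K) (hk0 : ∀ j, k j ≠ 0) {A : ℝ} {a : L1 (Idx d)}
    (ha : damping Idx.deg 4 a = dataVec hk A) (t : ℝ) :
    zeroMode (damping Idx.deg 4 (interaction Idx.deg (scaledPhase N) (1, 0) F t a))
      = -Complex.I * (μ * ((A : ℂ) ^ (2 * σ + 1) * phaseSum k σ N t)) := by
  have hflow := hΦ.isAdmissible.damping_interaction (θ := scaledPhase N) (η := 0) (η' := 2) (1, 0)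
    t a
  have hdata : phase Idx.deg (scaledPhase N) 2 (t, 0) (damping Idx.deg 2 a)
      = freePhase N 0 (t, 0) (dataVec hk A) := by
    rw [← ha, phase_damping, phase_damping]
    norm_num
  rw [Prod.smul_mk, Prod.smul_mk, smul_zero, smul_zero, smul_eq_mul, smul_eq_mul, mul_one, mul_one,
    hdata, zero_add, show (2 : ℝ≥0) + 2 = 4 by norm_num] at hflow
  rw [hflow, map_smul, zeroMode_freePhase, ← phase_zero_right (θ := scaledPhase N), phase_zero_zero,
    one_apply_eq_self, hΦ.zeroMode_apply (zeroMode_freePhase_dataVec hk hk0 _ A),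
    zeroMode_oddPower_freePhase_dataVec, smul_eq_mul]

theorem IsPowerLike.norm_distFourierCoeff_field_add_le (hΦ : IsPowerLike Φ F σ μ) (hN : N ≠ 0)
    (hk : ∀ j i, |k j i| ≤ K) (hk0 : ∀ j, k j ≠ 0) {A t E : ℝ} {a₀ : L1 (Idx d)}
    {a : ℝ → L1 (Idx d)} (ha₀ : damping Idx.deg 4 a₀ = dataVec hk A)
    (hE : ‖a t - a₀ - ∫ u in (0 : ℝ)..t, interaction Idx.deg (scaledPhase N) (1, 0) F u a₀‖ ≤ E) :
    ‖distFourierCoeff (toDistribution (field N a t)) 0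
      + Complex.I * (μ * ((A : ℂ) ^ (2 * σ + 1) * ∫ u in (0 : ℝ)..t, phaseSum k σ N u))‖ ≤ E := by
  set Z : L1 (Idx d) →L[ℂ] ℂ := zeroMode.comp (damping Idx.deg 4) with hZ
  have hZnorm : ∀ w, ‖Z w‖ ≤ ‖w‖ := fun w =>
    ((zeroMode.le_of_opNorm_le norm_zeroMode_le _).trans_eq (one_mul _)).trans
      ((norm_diag_apply_le (norm_exp_neg_deg_le Idx.deg 4) w).trans_eq (one_mul _))
  have hZ₀ : Z a₀ = 0 := by
    have h := zeroMode_freePhase_dataVec (N := N) hk hk0 0 A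
    rwa [freePhase, phase_zero_zero, one_apply_eq_self, ← ha₀] at h
  have hZint : Z (∫ u in (0 : ℝ)..t, interaction Idx.deg (scaledPhase N) (1, 0) F u a₀)
      = -Complex.I * (μ * ((A : ℂ) ^ (2 * σ + 1) * ∫ u in (0 : ℝ)..t, phaseSum k σ N u)) := by
    rw [← Z.intervalIntegral_comp_comm ((continuous_interaction
      hΦ.isAdmissible.contDiff.continuous _ a₀).intervalIntegrable _ _)]
    simp only [hZ, ContinuousLinearMap.comp_apply, hΦ.zeroMode_damping_interaction hk hk0 ha₀,
      intervalIntegral.integral_const_mul]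
  have h := (hZnorm _).trans hE
  rwa [map_sub, map_sub, hZ₀, sub_zero, hZint, neg_mul, sub_neg_eq_add, hZ,
    ContinuousLinearMap.comp_apply, ← distFourierCoeff_field_zero hN] at h

theorem exists_nat_forall_abs_le {ι κ : Type*} [Finite ι] [Finite κ] (k : ι → κ → ℤ) :
    ∃ K : ℕ, ∀ j i, |k j i| ≤ K := by
  obtain ⟨K, hK⟩ := (Set.finite_range fun q : ι × κ => (k q.1 q.2).natAbs).bddAbove
  refine ⟨K, fun j i => ?_⟩
  rw [Int.abs_eq_natAbs]
  exact_mod_cast hK ⟨(j, i), rfl⟩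

theorem IsPowerLike.exists_solution (hΦ : IsPowerLike Φ F σ μ) (hk0 : ∀ j, k j ≠ 0) :
    ∃ C : ℝ, 0 < C ∧ ∀ (N : ℕ) (A τ : ℝ), N ≠ 0 → 0 < A → 0 < τ → C * A ^ (2 * σ) * τ ≤ 1 →
      ∃ ψ : ℝ → SmoothTorus d, IsSmoothSolution Φ (Set.Ioo (-τ) τ) ψ ∧
        (∀ x, ψ 0 x = ∑ j, (A : ℂ) * character (N • k j) x) ∧
        ContinuousOn (fun t => distFourierCoeff (toDistribution (ψ t)) 0) (Set.Ioo (-τ) τ) ∧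
        ∀ t ∈ Set.Ico 0 τ, ‖distFourierCoeff (toDistribution (ψ t)) 0
            + Complex.I * (μ * ((A : ℂ) ^ (2 * σ + 1) * ∫ u in (0 : ℝ)..t, phaseSum k σ N u))‖
          ≤ C * A ^ (4 * σ + 1) * t ^ 2 := by
  obtain ⟨K, hk⟩ := exists_nat_forall_abs_le k
  obtain ⟨C, hC, hsol⟩ := hΦ.isAdmissible.exists_interaction_solution (Q := ℝ × (Fin d → ℝ))
  -- The data are enlarged by the factor that the damping of `field` removes.
  set m : ℝ := (Fintype.card J + 1) * Real.exp (4 * K) with hm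
  have hm1 : 1 ≤ m := one_le_mul_of_one_le_of_one_le (by simp) (Real.one_le_exp (by positivity))
  refine ⟨C * m ^ (4 * σ + 1), by positivity, fun N A τ hN hA hτ hAτ => ?_⟩
  have hnorm : ‖dataVec hk (Real.exp (4 * K) * A)‖ ≤ m * A := by
    refine (norm_dataVec_le hk (by positivity)).trans ?_
    rw [hm, mul_assoc]
    gcongr
    linarith
  have hdata : damping Idx.deg 4 (dataVec hk (Real.exp (4 * K) * A)) = dataVec hk A := by
    rw [damping_dataVec, ← mul_assoc, ← Real.exp_add]
    simp
  obtain ⟨a, ha0, ha, hest⟩ := hsol (scaledPhase N) (1, 0) _ (m * A) τ hnorm hτ (by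
    refine le_trans ?_ hAτ
    rw [mul_pow, ← mul_assoc]
    gcongr
    omega)
  refine ⟨field N a, isSmoothSolution_field hΦ.isAdmissible (hΦ.apply_synth hN) hτ ha,
    field_zero_apply hk (by rw [ha0, hdata]), ?_, fun t ht => ?_⟩
  · simp only [distFourierCoeff_field_zero hN]
    exact (zeroMode.comp (damping Idx.deg 4)).continuous.comp_continuousOn
      fun t ht => (ha t ht).continuousAt.continuousWithinAt
  · refine hΦ.norm_distFourierCoeff_field_add_le hN hk hk0 hdata ((hest t ht).trans_eq ?_)
    rw [mul_pow]
    ring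

end Solution

section Norms

variable {d : ℕ}

theorem enorm_distFourierCoeff_zero_le (r : ℝ) (p : ℝ≥0∞) [hp : Fact (1 ≤ p)]
    (u : TorusDistribution d) : ‖distFourierCoeff u 0‖ₑ ≤ flENorm r p u := by
  refine le_iInf fun hu => enorm_le_iff_norm_le.2 ?_
  have hzero : weightedCoeff r u 0 = distFourierCoeff u 0 := by simp [weightedCoeff]
  rw [← hzero]
  exact lp.norm_apply_le_norm (zero_lt_one.trans_le hp.out).ne' (FL.toLp d r p ⟨u, hu⟩) 0

theorem norm_distFourierCoeff_le_of_timeSupNorm_le {r : ℝ} {p : ℝ≥0∞} [Fact (1 ≤ p)] {T : ℝ}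
    {J : Set ℝ} (hJ : IsOpen J) {ψ : ℝ → SmoothTorus d} {M : ℝ≥0} (hM : timeSupNorm r p T J ψ ≤ M)
    (hψ : ContinuousOn (fun t => distFourierCoeff (toDistribution (ψ t)) 0) J) {t : ℝ}
    (ht : t ∈ Set.Ioo 0 T ∩ J) : ‖distFourierCoeff (toDistribution (ψ t)) 0‖ ≤ M := by
  set f : ℝ → ℝ := fun t => ‖distFourierCoeff (toDistribution (ψ t)) 0‖
  have hopen : IsOpen (Set.Ioo 0 T ∩ J) := isOpen_Ioo.inter hJ
  have hae : ∀ᵐ τ ∂(MeasureTheory.volume.restrict (Set.Ioo 0 T ∩ J)), f τ ≤ M := by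
    filter_upwards [ENNReal.ae_le_essSup (μ := MeasureTheory.volume.restrict (Set.Ioo 0 T ∩ J))
      (fun t => flENorm r p (toDistribution (ψ t)))] with τ hτ
    exact enorm_le_coe.1 ((enorm_distFourierCoeff_zero_le r p _).trans (hτ.trans hM))
  by_contra! hlt
  have hexceed : IsOpen ((Set.Ioo 0 T ∩ J) ∩ f ⁻¹' Set.Ioi (M : ℝ)) :=
    (hψ.mono Set.inter_subset_right).norm.isOpen_inter_preimage hopen isOpen_Ioi
  rw [MeasureTheory.ae_restrict_iff' hopen.measurableSet] at hae
  refine (hexceed.measure_pos MeasureTheory.volume ⟨t, ht, hlt⟩).ne'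
    (MeasureTheory.measure_mono_null (fun τ hτ => ?_) hae)
  exact fun h => not_le.2 hτ.2 (h hτ.1)

variable {J : Type} [Fintype J] {k : J → Fin d → ℤ}

theorem distFourierCoeff_of_eq_sum_character {f : SmoothTorus d} {A : ℂ}
    (hf : ∀ x, f x = ∑ j, A * character (k j) x) (n : Fin d → ℤ) :
    distFourierCoeff (toDistribution f) n = ∑ j, if n = k j then A else 0 := by
  have hprod : ∀ x, f x * character (-n) x = ∑ j, A * character (k j + -n) x := fun x => by
    simp only [hf, Finset.sum_mul, mul_assoc, character_add]
  rw [distFourierCoeff_toDistribution]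
  simp only [hprod]
  rw [MeasureTheory.integral_finsetSum _ fun j _ =>
    (integrableOn_cell (character (k j + -n)).2.1.continuous).const_mul A, Finset.mul_sum]
  refine Finset.sum_congr rfl fun j _ => ?_
  rw [MeasureTheory.integral_const_mul, integral_cell_character, mul_left_comm, mul_ite, mul_zero,
    inv_mul_cancel₀ (two_pi_pow_ne_zero d), mul_ite, mul_one, mul_zero]
  simp only [← sub_eq_add_neg, sub_eq_zero, eq_comm]

theorem exists_FL_of_eq_sum_character (s : ℝ) (p : ℝ≥0∞) [hp : Fact (1 ≤ p)] {f : SmoothTorus d}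
    {A B : ℝ} (hA : 0 ≤ A) (hf : ∀ x, f x = ∑ j, (A : ℂ) * character (k j) x)
    (hB : ∀ j, √(1 + ∑ i, (k j i : ℝ) ^ 2) ^ s ≤ B) :
    ∃ u : FL d s p, (u : TorusDistribution d) = toDistribution f ∧
      ‖u‖ ≤ Fintype.card J * (B * A) := by
  set g : lp (fun _ : Fin d → ℤ => ℂ) p :=
    ∑ j, lp.single p (k j) ((√(1 + ∑ i, (k j i : ℝ) ^ 2) ^ s * A : ℝ) : ℂ) with hg
  have hcoeff : weightedCoeff s (toDistribution f) = g := by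
    funext n
    rw [hg, lp.coeFn_sum, Finset.sum_apply, weightedCoeff, distFourierCoeff_of_eq_sum_character hf,
      Finset.mul_sum]
    refine Finset.sum_congr rfl fun j _ => ?_
    rw [lp.single_apply, Pi.single_apply, mul_ite, mul_zero]
    exact if_ctx_congr Iff.rfl (fun h => by rw [h]; push_cast; rfl) fun _ => rfl
  have hmem : toDistribution f ∈ FL d s p := by
    change Memℓp (weightedCoeff s (toDistribution f)) p
    rw [hcoeff]
    exact lp.memℓp g
  refine ⟨⟨toDistribution f, hmem⟩, rfl, ?_⟩
  change ‖FL.toLp d s p ⟨toDistribution f, hmem⟩‖ ≤ _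
  rw [show FL.toLp d s p ⟨toDistribution f, hmem⟩ = g from lp.ext hcoeff]
  refine (norm_sum_le_of_le _ fun j _ => ?_).trans_eq
    (by rw [Finset.sum_const, Finset.card_univ, nsmul_eq_mul])
  rw [lp.norm_single (zero_lt_one.trans_le hp.out), Complex.norm_real,
    Real.norm_of_nonneg (by positivity)]
  exact mul_le_mul_of_nonneg_right (hB j) hA

theorem bracket_nsmul_rpow_le {s : ℝ} (hs : s ≤ 0) {N : ℕ} (hN : N ≠ 0) {k : Fin d → ℤ}
    (hk : k ≠ 0) : √(1 + ∑ i, ((N • k) i : ℝ) ^ 2) ^ s ≤ (N : ℝ) ^ s := by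
  obtain ⟨i, hi⟩ := Function.ne_iff.1 hk
  refine Real.rpow_le_rpow_of_nonpos (by positivity) (Real.le_sqrt_of_sq_le ?_) hs
  have hki : (1 : ℝ) ≤ (k i : ℝ) ^ 2 := by
    exact_mod_cast (one_le_sq_iff_one_le_abs (k i)).2 (Int.one_le_abs hi)
  calc (N : ℝ) ^ 2 ≤ (N : ℝ) ^ 2 * (k i : ℝ) ^ 2 := le_mul_of_one_le_right (by positivity) hki
    _ = ((N • k) i : ℝ) ^ 2 := by simp [mul_pow]
    _ ≤ ∑ i, ((N • k) i : ℝ) ^ 2 :=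
      Finset.single_le_sum (f := fun i => ((N • k) i : ℝ) ^ 2) (fun i _ => sq_nonneg _)
        (Finset.mem_univ i)
    _ ≤ 1 + ∑ i, ((N • k) i : ℝ) ^ 2 := le_add_of_nonneg_left zero_le_one

end Norms

section AmplitudeBound

variable {d σ : ℕ} {μ : ℂ} {F : L1 (Idx d) → L1 (Idx d)} {Φ : SmoothTorus d → (Fin d → ℝ) → ℂ}
  {J : Type} [Fintype J] {k : J → Fin d → ℤ} {s r T : ℝ} {p₁ p₂ : ℝ≥0∞} [Fact (1 ≤ p₁)]
  [Fact (1 ≤ p₂)] {U : Set (FL d s p₁)} {M : ℝ≥0 → ℝ≥0}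

theorem AprioriEstimate.exists_norm_distFourierCoeff_zero_le
    (h : AprioriEstimate Φ s p₁ r p₂ T U M) (hU : U ∈ 𝓝 0)
    (hM : (𝓝 0).IsBoundedUnder (· ≤ ·) M) (hs : s ≤ 0) (hk0 : ∀ j, k j ≠ 0) :
    ∃ ε > 0, ∃ B : ℝ, ∀ (N : ℕ) (A : ℝ), N ≠ 0 → 0 ≤ A → (N : ℝ) ^ s * A < ε →
      ∀ I ψ, IsSmoothSolution Φ I ψ → (∀ x, ψ 0 x = ∑ j, (A : ℂ) * character (N • k j) x) →
        ContinuousOn (fun t => distFourierCoeff (toDistribution (ψ t)) 0) I →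
        ∀ t ∈ Set.Ioo 0 T ∩ I, ‖distFourierCoeff (toDistribution (ψ t)) 0‖ ≤ B := by
  obtain ⟨B, hB⟩ := hM
  have hnear : ∀ᶠ u : FL d s p₁ in 𝓝 0, M ‖u‖₊ ≤ B :=
    (continuous_nnnorm.tendsto' 0 0 nnnorm_zero).eventually (Filter.eventually_map.1 hB)
  obtain ⟨ε, hε, hball⟩ := Metric.eventually_nhds_iff.1 (hnear.and hU)
  set m : ℝ := Fintype.card J + 1
  have hm : 0 < m := by positivity
  refine ⟨ε / m, by positivity, B, fun N A hN hA hNA I ψ hψ hψ₀ hcont t ht => ?_⟩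
  obtain ⟨u, hu, hu_norm⟩ := exists_FL_of_eq_sum_character s p₁ hA hψ₀
    fun j => bracket_nsmul_rpow_le hs hN (hk0 j)
  have hu_small : ‖u‖ < ε :=
    calc ‖u‖ ≤ Fintype.card J * ((N : ℝ) ^ s * A) := hu_norm
      _ ≤ m * ((N : ℝ) ^ s * A) := by
        gcongr
        exact le_add_of_nonneg_right zero_le_one
      _ < m * (ε / m) := by gcongr
      _ = ε := mul_div_cancel₀ ε hm.ne'
  obtain ⟨hMu, huU⟩ := hball (y := u) (by rwa [dist_zero_right])
  exact (norm_distFourierCoeff_le_of_timeSupNorm_le hψ.isOpen (h I ψ hψ u huU hu) hcont ht).trans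
    (NNReal.coe_le_coe.2 hMu)

theorem IsPowerLike.exists_amplitude_bound (hΦ : IsPowerLike Φ F σ μ) (hμ : μ ≠ 0)
    (h : AprioriEstimate Φ s p₁ r p₂ T U M) (hU : U ∈ 𝓝 0)
    (hM : (𝓝 0).IsBoundedUnder (· ≤ ·) M) (hs : s ≤ 0) (hk0 : ∀ j, k j ≠ 0) :
    ∃ ε > 0, ∃ δ > 0, ∃ B : ℝ, ∀ (N : ℕ) (A t : ℝ), N ≠ 0 → 0 < A → t ∈ Set.Ioo 0 T →
      (N : ℝ) ^ s * A < ε → A ^ (2 * σ) * t ≤ δ →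
      t / 2 ≤ ‖∫ u in (0 : ℝ)..t, phaseSum k σ N u‖ → A ^ (2 * σ + 1) * t ≤ B := by
  obtain ⟨ε, hε, B, hbound⟩ := h.exists_norm_distFourierCoeff_zero_le hU hM hs hk0
  obtain ⟨C, hC, hsol⟩ := hΦ.exists_solution hk0
  have hμ' : 0 < ‖μ‖ := norm_pos_iff.2 hμ
  refine ⟨ε, hε, min (1 / (2 * C)) (‖μ‖ / (4 * C)), by positivity, 4 * B / ‖μ‖, ?_⟩
  intro N A t hN hA ⟨ht, htT⟩ hNA hAt hphase
  obtain ⟨hAt₁, hAt₂⟩ := le_min_iff.1 hAt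
  rw [le_div_iff₀ (by positivity)] at hAt₁ hAt₂
  obtain ⟨ψ, hψ, hψ₀, hcont, happrox⟩ := hsol N A (2 * t) hN hA (by positivity) (by linarith)
  have hz := hbound N A hN hA.le hNA _ ψ hψ hψ₀ hcont t ⟨⟨ht, htT⟩, by constructor <;> linarith⟩
  set z := distFourierCoeff (toDistribution (ψ t)) 0
  set P := ∫ u in (0 : ℝ)..t, phaseSum k σ N u
  have hlower : ‖μ‖ * (A ^ (2 * σ + 1) * (t / 2))
      ≤ ‖Complex.I * (μ * ((A : ℂ) ^ (2 * σ + 1) * P))‖ := by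
    rw [norm_mul, norm_mul, norm_mul, norm_pow, Complex.norm_I, one_mul, Complex.norm_real,
      Real.norm_of_nonneg hA.le]
    gcongr
  have hupper : ‖Complex.I * (μ * ((A : ℂ) ^ (2 * σ + 1) * P))‖ ≤ C * A ^ (4 * σ + 1) * t ^ 2 + B :=
    (norm_le_add_norm_add' z _).trans (add_le_add (happrox t ⟨ht.le, by linarith⟩) hz)
  have herror : C * A ^ (4 * σ + 1) * t ^ 2 ≤ ‖μ‖ / 4 * (A ^ (2 * σ + 1) * t) :=
    calc C * A ^ (4 * σ + 1) * t ^ 2 = C * (A ^ (2 * σ) * t) * (A ^ (2 * σ + 1) * t) := by ring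
      _ ≤ ‖μ‖ / 4 * (A ^ (2 * σ + 1) * t) := by
        gcongr
        linarith
  rw [le_div_iff₀ hμ']
  linarith

end AmplitudeBound

section PhaseIntegrals

variable {d σ N : ℕ} {J : Type} [Fintype J] {k : J → Fin d → ℤ} {t : ℝ}

theorem norm_integral_exp_le {ν : ℝ} (hν : ν ≠ 0) (t : ℝ) :
    ‖∫ u in (0 : ℝ)..t, Complex.exp (-Complex.I * (ν * u : ℝ))‖ ≤ 2 / |ν| := by
  have hIν : -Complex.I * (ν : ℂ) ≠ 0 :=
    mul_ne_zero (neg_ne_zero.2 Complex.I_ne_zero) (Complex.ofReal_ne_zero.2 hν)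
  have hunit : ∀ u : ℝ, ‖Complex.exp (-Complex.I * ν * u)‖ = 1 := fun u => by
    rw [show -Complex.I * ν * u = ((-(ν * u) : ℝ) : ℂ) * Complex.I by push_cast; ring,
      Complex.norm_exp_ofReal_mul_I]
  simp only [Complex.ofReal_mul, ← mul_assoc]
  rw [integral_exp_mul_complex hIν, norm_div, norm_mul, norm_neg, Complex.norm_I, one_mul,
    Complex.norm_real, Real.norm_eq_abs]
  gcongr
  exact (norm_sub_le _ _).trans_eq (by rw [hunit, hunit, one_add_one_eq_two])

theorem le_re_integral_exp_resonance (hN : N ≠ 0) (t : ℝ) (m : ℤ) :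
    (if m = 0 then t else 0) - 4 / (N : ℝ) ^ 2
      ≤ (∫ u in (0 : ℝ)..t, Complex.exp (-Complex.I * ((N : ℝ) ^ 2 / 2 * m * u : ℝ))).re := by
  have hN' : (0 : ℝ) < (N : ℝ) ^ 2 := by positivity
  split_ifs with hm
  · simp only [hm, Int.cast_zero, mul_zero, zero_mul, Complex.ofReal_zero, Complex.exp_zero,
      intervalIntegral.integral_const, Complex.real_smul, mul_one, Complex.ofReal_re, sub_zero]
    linarith [show 0 ≤ 4 / (N : ℝ) ^ 2 by positivity]
  · have hfreq : (N : ℝ) ^ 2 / 2 ≤ |(N : ℝ) ^ 2 / 2 * m| := by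
      rw [abs_mul, abs_of_nonneg (by positivity : 0 ≤ (N : ℝ) ^ 2 / 2)]
      exact le_mul_of_one_le_right (by positivity) (by exact_mod_cast Int.one_le_abs hm)
    rw [zero_sub]
    refine neg_le_of_abs_le ((Complex.abs_re_le_norm _).trans
      ((norm_integral_exp_le (abs_pos.1 (by linarith)) t).trans ?_))
    calc 2 / |(N : ℝ) ^ 2 / 2 * m| ≤ 2 / ((N : ℝ) ^ 2 / 2) := by gcongr
      _ = 4 / (N : ℝ) ^ 2 := by field_simp; norm_num

theorem continuous_phaseSum (k : J → Fin d → ℤ) (σ N : ℕ) : Continuous (phaseSum k σ N) := by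
  unfold phaseSum
  fun_prop

theorem integral_phaseSum_ge_of_resonant {l₀ : Tup J σ} (hl₀ : Tup.alt Neg.neg k σ l₀ = 0)
    (hres : resonance k σ l₀ = 0) (hN : N ≠ 0) (ht : 0 ≤ t) :
    t - Fintype.card (Tup J σ) * (4 / (N : ℝ) ^ 2) ≤ ‖∫ u in (0 : ℝ)..t, phaseSum k σ N u‖ := by
  set S : Finset (Tup J σ) := {l | Tup.alt Neg.neg k σ l = 0} with hS
  have hint : ∫ u in (0 : ℝ)..t, phaseSum k σ N u = ∑ l ∈ S, ∫ u in (0 : ℝ)..t,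
      Complex.exp (-Complex.I * ((N : ℝ) ^ 2 / 2 * resonance k σ l * u : ℝ)) :=
    intervalIntegral.integral_finsetSum fun l _ => Continuous.intervalIntegrable (by fun_prop) _ _
  have hmain : t ≤ ∑ l ∈ S, if resonance k σ l = 0 then t else 0 := by
    refine (if_pos hres).symm.trans_le (Finset.single_le_sum
      (f := fun l => if resonance k σ l = 0 then t else 0) (fun l _ => ?_)
      (by simpa [hS] using hl₀))
    split_ifs <;> simp [ht]
  have hcard : (S.card : ℝ) ≤ Fintype.card (Tup J σ) := by exact_mod_cast S.card_le_univ
  calc t - Fintype.card (Tup J σ) * (4 / (N : ℝ) ^ 2)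
      ≤ ∑ l ∈ S, ((if resonance k σ l = 0 then t else 0) - 4 / (N : ℝ) ^ 2) := by
        rw [Finset.sum_sub_distrib, Finset.sum_const, nsmul_eq_mul]
        gcongr
    _ ≤ (∫ u in (0 : ℝ)..t, phaseSum k σ N u).re := by
        rw [hint, Complex.re_sum]
        exact Finset.sum_le_sum fun l _ => le_re_integral_exp_resonance hN t _
    _ ≤ ‖∫ u in (0 : ℝ)..t, phaseSum k σ N u‖ := Complex.re_le_norm _

theorem eventually_half_le_norm_integral_phaseSum {l₀ : Tup J σ}
    (hl₀ : Tup.alt Neg.neg k σ l₀ = 0) (hres : resonance k σ l₀ = 0) (ht : 0 < t) :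
    ∀ᶠ N : ℕ in Filter.atTop, t / 2 ≤ ‖∫ u in (0 : ℝ)..t, phaseSum k σ N u‖ := by
  have hlim : Filter.Tendsto (fun N : ℕ => (Fintype.card (Tup J σ) : ℝ) * (4 / (N : ℝ) ^ 2))
      Filter.atTop (𝓝 ((Fintype.card (Tup J σ) : ℝ) * 0)) :=
    (tendsto_const_nhds.div_atTop ((Filter.tendsto_pow_atTop two_ne_zero).comp
      tendsto_natCast_atTop_atTop)).const_mul _
  rw [mul_zero] at hlim
  filter_upwards [hlim.eventually_lt_const (half_pos ht), Filter.eventually_ne_atTop 0]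
    with N hlt hN
  linarith [integral_phaseSum_ge_of_resonant hl₀ hres hN ht.le]

theorem half_le_re_exp {y : ℝ} (hy : |y| ≤ 1) : 1 / 2 ≤ (Complex.exp (-Complex.I * y)).re := by
  rw [show -Complex.I * (y : ℂ) = ((-y : ℝ) : ℂ) * Complex.I by push_cast; ring,
    Complex.exp_ofReal_mul_I_re, Real.cos_neg]
  linarith [Real.one_sub_sq_div_two_le_cos (x := y), (sq_le_one_iff_abs_le_one y).2 hy]

theorem half_le_re_phaseSum {l₀ : Tup J σ} (hl₀ : Tup.alt Neg.neg k σ l₀ = 0)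
    (ht : ∀ l : Tup J σ, |(N : ℝ) ^ 2 / 2 * resonance k σ l * t| ≤ 1) :
    1 / 2 ≤ (phaseSum k σ N t).re := by
  rw [phaseSum, Complex.re_sum]
  exact (half_le_re_exp (ht l₀)).trans (Finset.single_le_sum (f := fun l : Tup J σ =>
    (Complex.exp (-Complex.I * ((N : ℝ) ^ 2 / 2 * resonance k σ l * t : ℝ))).re)
    (fun l _ => one_half_pos.le.trans (half_le_re_exp (ht l))) (by simpa using hl₀))

theorem half_le_norm_integral_of_half_le_re {f : ℝ → ℂ} (hf : Continuous f) (ht : 0 ≤ t)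
    (hre : ∀ u ∈ Set.Icc 0 t, 1 / 2 ≤ (f u).re) : t / 2 ≤ ‖∫ u in (0 : ℝ)..t, f u‖ :=
  calc t / 2 = ∫ _ in (0 : ℝ)..t, (1 / 2 : ℝ) := by
        rw [intervalIntegral.integral_const, smul_eq_mul]
        ring
    _ ≤ ∫ u in (0 : ℝ)..t, Complex.reCLM (f u) := intervalIntegral.integral_mono_on ht (by simp)
        ((Complex.reCLM.continuous.comp hf).intervalIntegrable _ _) hre
    _ = (∫ u in (0 : ℝ)..t, f u).re :=
        Complex.reCLM.intervalIntegral_comp_comm (hf.intervalIntegrable _ _)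
    _ ≤ ‖∫ u in (0 : ℝ)..t, f u‖ := Complex.re_le_norm _

theorem exists_half_le_norm_integral_phaseSum {l₀ : Tup J σ}
    (hl₀ : Tup.alt Neg.neg k σ l₀ = 0) :
    ∃ c > 0, ∀ N : ℕ, N ≠ 0 →
      c / (N : ℝ) ^ 2 / 2 ≤ ‖∫ u in (0 : ℝ)..(c / (N : ℝ) ^ 2), phaseSum k σ N u‖ := by
  set R : ℝ := ∑ l, |(resonance k σ l : ℝ)|
  have hR : ∀ l, |(resonance k σ l : ℝ)| ≤ R := fun l =>
    Finset.single_le_sum (f := fun l => |(resonance k σ l : ℝ)|) (fun l _ => abs_nonneg _)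
      (Finset.mem_univ l)
  have hR₀ : 0 ≤ R := (abs_nonneg _).trans (hR l₀)
  refine ⟨1 / (R + 1), by positivity, fun N hN => half_le_norm_integral_of_half_le_re
    (continuous_phaseSum k σ N) (by positivity) fun u hu => half_le_re_phaseSum hl₀ fun l => ?_⟩
  calc |(N : ℝ) ^ 2 / 2 * resonance k σ l * u|
      = (N : ℝ) ^ 2 / 2 * |(resonance k σ l : ℝ)| * u := by
        rw [abs_mul, abs_mul, abs_of_nonneg hu.1,
          abs_of_nonneg (by positivity : 0 ≤ (N : ℝ) ^ 2 / 2)]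
    _ ≤ (N : ℝ) ^ 2 / 2 * (R + 1) * (1 / (R + 1) / (N : ℝ) ^ 2) :=
        mul_le_mul (by gcongr; linarith [hR l]) hu.2 hu.1 (by positivity)
    _ = 1 / 2 := by field_simp
    _ ≤ 1 := by norm_num

end PhaseIntegrals

section Inflation

theorem tendsto_natCast_rpow_of_neg {b : ℝ} (hb : b < 0) :
    Filter.Tendsto (fun N : ℕ => (N : ℝ) ^ b) Filter.atTop (𝓝 0) := by
  simpa only [neg_neg, Function.comp_def] using
    (tendsto_rpow_neg_atTop (neg_pos.2 hb)).comp tendsto_natCast_atTop_atTop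

theorem exists_large_amplitude {σ : ℕ} (hσ : σ ≠ 0) {s c ε δ T : ℝ} (hs : s < -2 / (2 * σ + 1))
    (hc : 0 < c) (hε : 0 < ε) (hδ : 0 < δ) (hT : 0 < T) (B : ℝ) :
    ∃ (N : ℕ) (A : ℝ), N ≠ 0 ∧ 0 < A ∧ (N : ℝ) ^ s * A < ε ∧ c / (N : ℝ) ^ 2 < T ∧
      A ^ (2 * σ) * (c / (N : ℝ) ^ 2) ≤ δ ∧ B < A ^ (2 * σ + 1) * (c / (N : ℝ) ^ 2) := by
  have hσ' : (0 : ℝ) < σ := by positivity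
  rw [neg_div, lt_neg] at hs
  -- The amplitude is `A = N ^ a`.
  obtain ⟨a, ha, ha'⟩ : ∃ a : ℝ, 2 / (2 * (σ : ℝ) + 1) < a ∧ a < min (2 / (2 * (σ : ℝ))) (-s) :=
    exists_between (lt_min (by gcongr; linarith) hs)
  obtain ⟨haσ, has⟩ := lt_min_iff.1 ha'
  rw [div_lt_iff₀ (by positivity)] at ha
  rw [lt_div_iff₀ (by positivity)] at haσ
  have hsmall := (tendsto_natCast_rpow_of_neg (by linarith : s + a < 0)).eventually_lt_const hε
  have htime := ((tendsto_natCast_rpow_of_neg (by norm_num : (-2 : ℝ) < 0)).const_mul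
    c).eventually_lt_const (by rwa [mul_zero] : c * 0 < T)
  have hshort := ((tendsto_natCast_rpow_of_neg (by linarith : a * (2 * σ) + -2 < 0)).const_mul
    c).eventually_lt_const (by rwa [mul_zero] : c * 0 < δ)
  have hlarge := (((tendsto_rpow_atTop (by linarith : 0 < a * (2 * σ + 1) + -2)).comp
    (tendsto_natCast_atTop_atTop (R := ℝ))).const_mul_atTop hc).eventually_gt_atTop B
  obtain ⟨N, hN, hNs, hNT, hNδ, hNB⟩ := ((Filter.eventually_ne_atTop 0).and
    (hsmall.and (htime.and (hshort.and hlarge)))).exists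
  have hN₀ : (0 : ℝ) < N := by positivity
  have ht : c / (N : ℝ) ^ 2 = c * (N : ℝ) ^ (-2 : ℝ) := by
    rw [Real.rpow_neg hN₀.le, Real.rpow_two, div_eq_mul_inv]
  have hAt : ∀ n : ℕ, ((N : ℝ) ^ a) ^ n * (c / (N : ℝ) ^ 2) = c * (N : ℝ) ^ (a * n + -2) :=
    fun n => by rw [ht, ← Real.rpow_mul_natCast hN₀.le, Real.rpow_add hN₀]; ring
  refine ⟨N, (N : ℝ) ^ a, hN, by positivity, ?_, ht ▸ hNT, ?_, ?_⟩
  · rwa [← Real.rpow_add hN₀]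
  · rw [hAt]
    exact_mod_cast hNδ.le
  · rw [hAt]
    exact_mod_cast hNB

theorem exponent_ne_zero_of_alt_eq_zero {d σ : ℕ} {J : Type} {k : J → Fin d → ℤ}
    (hk0 : ∀ j, k j ≠ 0) {l₀ : Tup J σ} (hl₀ : Tup.alt Neg.neg k σ l₀ = 0) : σ ≠ 0 := by
  rintro rfl
  exact hk0 l₀ hl₀

variable {d σ : ℕ} {μ : ℂ} {F : L1 (Idx d) → L1 (Idx d)} {Φ : SmoothTorus d → (Fin d → ℝ) → ℂ}
  {J : Type} [Finite J] {k : J → Fin d → ℤ} {s r T : ℝ} {p₁ p₂ : ℝ≥0∞} [Fact (1 ≤ p₁)]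
  [Fact (1 ≤ p₂)] {U : Set (FL d s p₁)} {M : ℝ≥0 → ℝ≥0}

theorem IsPowerLike.not_aprioriEstimate_of_resonant (hΦ : IsPowerLike Φ F σ μ) (hμ : μ ≠ 0)
    (hk0 : ∀ j, k j ≠ 0) {l₀ : Tup J σ} (hl₀ : Tup.alt Neg.neg k σ l₀ = 0)
    (hres : resonance k σ l₀ = 0) (hs : s < 0) (hT : 0 < T) (hU : U ∈ 𝓝 0)
    (hM : (𝓝 0).IsBoundedUnder (· ≤ ·) M) : ¬ AprioriEstimate Φ s p₁ r p₂ T U M := by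
  intro h
  cases nonempty_fintype J
  have hσ := exponent_ne_zero_of_alt_eq_zero hk0 hl₀
  obtain ⟨ε, hε, δ, hδ, B, hB⟩ := hΦ.exists_amplitude_bound hμ h hU hM hs.le hk0
  obtain ⟨A, hA, hAδ, hAT⟩ : ∃ A : ℝ, 0 < A ∧ B < A * δ ∧ δ / A ^ (2 * σ) < T :=
    ((Filter.eventually_gt_atTop 0).and
      (((Filter.tendsto_id.atTop_mul_const hδ).eventually_gt_atTop B).and
        ((tendsto_const_nhds.div_atTop
          (Filter.tendsto_pow_atTop (by positivity))).eventually_lt_const hT))).exists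
  have ht : 0 < δ / A ^ (2 * σ) := by positivity
  have hAt : A ^ (2 * σ) * (δ / A ^ (2 * σ)) = δ := mul_div_cancel₀ δ (by positivity)
  have hsmall := ((tendsto_natCast_rpow_of_neg hs).mul_const A).eventually_lt_const
    (show 0 * A < ε by rwa [zero_mul])
  obtain ⟨N, hN, hNA, hphase⟩ := ((Filter.eventually_ne_atTop 0).and (hsmall.and
    (eventually_half_le_norm_integral_phaseSum hl₀ hres ht))).exists
  refine (hB N A _ hN hA ⟨ht, hAT⟩ hNA hAt.le hphase).not_gt ?_
  rwa [pow_succ', mul_assoc, hAt]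

theorem IsPowerLike.not_aprioriEstimate_of_lt (hΦ : IsPowerLike Φ F σ μ) (hμ : μ ≠ 0)
    (hk0 : ∀ j, k j ≠ 0) {l₀ : Tup J σ} (hl₀ : Tup.alt Neg.neg k σ l₀ = 0)
    (hs : s < -2 / (2 * σ + 1)) (hT : 0 < T) (hU : U ∈ 𝓝 0)
    (hM : (𝓝 0).IsBoundedUnder (· ≤ ·) M) : ¬ AprioriEstimate Φ s p₁ r p₂ T U M := by
  intro h
  cases nonempty_fintype J
  have hσ := exponent_ne_zero_of_alt_eq_zero hk0 hl₀
  have hs₀ : s ≤ 0 := by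
    rw [neg_div] at hs
    linarith [show 0 < 2 / (2 * (σ : ℝ) + 1) by positivity]
  obtain ⟨ε, hε, δ, hδ, B, hB⟩ := hΦ.exists_amplitude_bound hμ h hU hM hs₀ hk0
  obtain ⟨c, hc, hphase⟩ := exists_half_le_norm_integral_phaseSum hl₀
  obtain ⟨N, A, hN, hA, hNA, hcT, hAδ, hAB⟩ := exists_large_amplitude hσ hs hc hε hδ hT B
  exact (hB N A (c / (N : ℝ) ^ 2) hN hA ⟨by positivity, hcT⟩ hNA hAδ (hphase N hN)).not_gt hAB

end Inflation

section Resonance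

variable {d : ℕ} {J : Type} {k : J → Fin d → ℤ}

theorem exists_resonant_tuple_add {σ : ℕ} (j : J)
    (h : ∃ l : Tup J σ, Tup.alt Neg.neg k σ l = 0 ∧ resonance k σ l = 0) (n : ℕ) :
    ∃ l : Tup J (σ + n), Tup.alt Neg.neg k (σ + n) l = 0 ∧ resonance k (σ + n) l = 0 := by
  induction n with
  | zero => exact h
  | succ n ih =>
    obtain ⟨l, hsum, hres⟩ := ih
    refine ⟨(j, j, l), ?_, ?_⟩
    · change k j + (-k j + Tup.alt Neg.neg k (σ + n) l) = 0
      rw [hsum, add_zero, add_neg_cancel]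
    · change _ + (-_ + resonance k (σ + n) l) = 0
      rw [hres, add_zero, add_neg_cancel]

theorem exists_resonant_tuple_of_two_le (hd : 2 ≤ d) :
    ∃ k : Fin 3 → Fin d → ℤ, (∀ j, k j ≠ 0) ∧
      ∃ l : Tup (Fin 3) 1, Tup.alt Neg.neg k 1 l = 0 ∧ resonance k 1 l = 0 := by
  obtain ⟨d, rfl⟩ := Nat.exists_eq_add_of_le' hd
  set e : Fin 2 → Fin (d + 2) → ℤ := ![Pi.single 0 1, Pi.single 1 1]
  refine ⟨![e 0, e 0 + e 1, e 1], fun j hj => ?_, ((0 : Fin 3), (1 : Fin 3), (2 : Fin 3)), ?_, ?_⟩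
  · fin_cases j
    · simpa [e] using congrFun hj 0
    · simpa [e] using congrFun hj 0
    · simpa [e] using congrFun hj 1
  · change e 0 + (-(e 0 + e 1) + e 1) = 0
    abel
  · have horth : ∀ i, (e 0 + e 1) i ^ 2 = e 0 i ^ 2 + e 1 i ^ 2 := fun i => by
      simp only [e, Matrix.cons_val_zero, Matrix.cons_val_one, Pi.add_apply, Pi.single_apply]
      split_ifs <;> simp_all
    change ∑ i, e 0 i ^ 2 + (-∑ i, (e 0 + e 1) i ^ 2 + ∑ i, e 1 i ^ 2) = 0
    simp only [horth, Finset.sum_add_distrib]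
    ring

theorem exists_resonant_tuple_one :
    ∃ k : Fin 5 → Fin 1 → ℤ, (∀ j, k j ≠ 0) ∧
      ∃ l : Tup (Fin 5) 2, Tup.alt Neg.neg k 2 l = 0 ∧ resonance k 2 l = 0 := by
  refine ⟨fun j _ => ![1, 4, 2, 5, 6] j, fun j hj => ?_,
    ((0 : Fin 5), (1 : Fin 5), (2 : Fin 5), (3 : Fin 5), (4 : Fin 5)), ?_, ?_⟩
  · have h0 := congrFun hj 0
    fin_cases j <;> simp at h0
  · funext i
    change (1 : ℤ) + (-4 + (2 + (-5 + 6))) = 0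
    norm_num
  · change ∑ _ : Fin 1, (1 : ℤ) ^ 2 + (-∑ _ : Fin 1, (4 : ℤ) ^ 2 + (∑ _ : Fin 1, (2 : ℤ) ^ 2
      + (-∑ _ : Fin 1, (5 : ℤ) ^ 2 + ∑ _ : Fin 1, (6 : ℤ) ^ 2))) = 0
    simp

theorem exists_resonant_tuple {σ : ℕ} (h : 2 ≤ d * σ) :
    ∃ (n : ℕ) (k : Fin n → Fin d → ℤ), (∀ j, k j ≠ 0) ∧
      ∃ l : Tup (Fin n) σ, Tup.alt Neg.neg k σ l = 0 ∧ resonance k σ l = 0 := by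
  have hd : d ≠ 0 := by rintro rfl; simp at h
  have hσ : σ ≠ 0 := by rintro rfl; simp at h
  obtain hd | rfl : 2 ≤ d ∨ d = 1 := by omega
  · obtain ⟨k, hk0, hl⟩ := exists_resonant_tuple_of_two_le hd
    obtain ⟨n, rfl⟩ := Nat.exists_eq_add_of_le (Nat.one_le_iff_ne_zero.2 hσ)
    exact ⟨3, k, hk0, exists_resonant_tuple_add 0 hl n⟩
  · obtain ⟨k, hk0, hl⟩ := exists_resonant_tuple_one
    obtain ⟨n, rfl⟩ := Nat.exists_eq_add_of_le (show 2 ≤ σ by omega)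
    exact ⟨5, k, hk0, exists_resonant_tuple_add 0 hl n⟩

end Resonance

section Conclusion

variable {d σ : ℕ} {μ : ℂ} {F : L1 (Idx d) → L1 (Idx d)} {Φ : SmoothTorus d → (Fin d → ℝ) → ℂ}
  {s r T : ℝ} {p₁ p₂ : ℝ≥0∞} [Fact (1 ≤ p₁)] [Fact (1 ≤ p₂)] {M : ℝ≥0 → ℝ≥0}

theorem IsPowerLike.not_aprioriEstimate (hΦ : IsPowerLike Φ F σ μ) (hμ : μ ≠ 0)
    (h : 2 ≤ d * σ ∧ s < 0 ∨ d = 1 ∧ σ = 1 ∧ s < -2 / 3) (hT : 0 < T) {U : Set (FL d s p₁)}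
    (hU : U ∈ 𝓝 0) (hM : (𝓝 0).IsBoundedUnder (· ≤ ·) M) :
    ¬ AprioriEstimate Φ s p₁ r p₂ T U M := by
  obtain ⟨h, hs⟩ | ⟨rfl, rfl, hs⟩ := h
  · obtain ⟨n, k, hk0, l, hsum, hres⟩ := exists_resonant_tuple h
    exact hΦ.not_aprioriEstimate_of_resonant hμ hk0 hsum hres hs hT hU hM
  · refine hΦ.not_aprioriEstimate_of_lt (k := fun (j : Fin 2) _ => (j : ℤ) + 1)
      (l₀ := ((0 : Fin 2), (1 : Fin 2), (0 : Fin 2))) hμ (fun j hj => ?_) ?_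
      (by norm_num at hs ⊢; exact hs) hT hU hM
    · have h0 := congrFun hj 0
      fin_cases j <;> simp at h0
    · funext i
      simp [Tup.alt]

theorem SobolevAprioriEstimate.aprioriEstimate (h : SobolevAprioriEstimate Φ s r T M) :
    AprioriEstimate Φ s 2 r 2 T Set.univ M :=
  fun I ψ hψ u _ hu => h I ψ hψ u hu

theorem IsPowerLike.forall_not_exists_aprioriEstimate (hΦ : IsPowerLike Φ F σ μ) (hμ : μ ≠ 0)
    (h : 2 ≤ d * σ ∧ s < 0 ∨ d = 1 ∧ σ = 1 ∧ s < -2 / 3) (hT : 0 < T) :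
    (∀ r : ℝ, ¬ ∃ U ∈ 𝓝 (0 : FL d s p₁), ∃ M : ℝ≥0 → ℝ≥0, (𝓝 0).IsBoundedUnder (· ≤ ·) M ∧
      AprioriEstimate Φ s p₁ r p₂ T U M) ∧
    (∀ r : ℝ, ¬ ∃ M : ℝ≥0 → ℝ≥0, (𝓝 0).IsBoundedUnder (· ≤ ·) M ∧
      SobolevAprioriEstimate Φ s r T M) :=
  ⟨fun _ ⟨_, hU, _, hM, hest⟩ => hΦ.not_aprioriEstimate hμ h hT hU hM hest,
    fun _ ⟨_, hM, hest⟩ => hΦ.not_aprioriEstimate hμ h hT Filter.univ_mem hM hest.aprioriEstimate⟩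

end Conclusion

end

end PeriodicNLS

open PeriodicNLS

theorem corollary1p2_general (d σ : ℕ) (μ : ℝ) (hμ : μ ≠ 0) (p₁ p₂ : ℝ≥0∞) [Fact (1 ≤ p₁)]
    [Fact (1 ≤ p₂)] (s T : ℝ) (hT : 0 < T) :
    ((2 ≤ d * σ ∧ s < 0 ∨ d = 1 ∧ σ = 1 ∧ s < -2 / 3) →
      (∀ r : ℝ, ¬ ∃ U ∈ 𝓝 (0 : FL d s p₁), ∃ M : ℝ≥0 → ℝ≥0, (𝓝 0).IsBoundedUnder (· ≤ ·) M ∧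
        AprioriEstimate (nlsTerm μ σ) s p₁ r p₂ T U M) ∧
      (∀ r : ℝ, ¬ ∃ M : ℝ≥0 → ℝ≥0, (𝓝 0).IsBoundedUnder (· ≤ ·) M ∧
        SobolevAprioriEstimate (d := d) (nlsTerm μ σ) s r T M)) ∧
    ((2 ≤ d ∧ s < 0 ∨ d = 1 ∧ s < -2 / 3) →
      (∀ r : ℝ, ¬ ∃ U ∈ 𝓝 (0 : FL d s p₁), ∃ M : ℝ≥0 → ℝ≥0, (𝓝 0).IsBoundedUnder (· ≤ ·) M ∧
        AprioriEstimate (renormalizedTerm μ) s p₁ r p₂ T U M) ∧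
      (∀ r : ℝ, ¬ ∃ M : ℝ≥0 → ℝ≥0, (𝓝 0).IsBoundedUnder (· ≤ ·) M ∧
        SobolevAprioriEstimate (d := d) (renormalizedTerm μ) s r T M)) := by
  have hμ' : (μ : ℂ) ≠ 0 := Complex.ofReal_ne_zero.2 hμ
  refine ⟨fun h => (isPowerLike_nlsTerm d σ μ).forall_not_exists_aprioriEstimate hμ' h hT,
    fun h => (isPowerLike_renormalizedTerm d μ).forall_not_exists_aprioriEstimate hμ' ?_ hT⟩
  simpa using h

theorem corollary1p2 (d σ : ℕ) (hd : 1 ≤ d) (hσ : 1 ≤ σ) (μ : ℝ) (hμ : μ = 1 ∨ μ = -1)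
    (p₁ p₂ : ℝ≥0∞) [Fact (1 ≤ p₁)] [Fact (1 ≤ p₂)] (s T : ℝ) (hT : 0 < T) :
    ((2 ≤ d * σ ∧ s < 0 ∨ d = 1 ∧ σ = 1 ∧ s < -2 / 3) →
      (∀ r : ℝ, ¬ ∃ U ∈ 𝓝 (0 : FL d s p₁), ∃ M : ℝ≥0 → ℝ≥0, Continuous M ∧
        AprioriEstimate (nlsTerm μ σ) s p₁ r p₂ T U M) ∧
      (∀ r : ℝ, ¬ ∃ M : ℝ≥0 → ℝ≥0, Continuous M ∧
        SobolevAprioriEstimate (d := d) (nlsTerm μ σ) s r T M)) ∧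
    ((2 ≤ d ∧ s < 0 ∨ d = 1 ∧ s < -2 / 3) →
      (∀ r : ℝ, ¬ ∃ U ∈ 𝓝 (0 : FL d s p₁), ∃ M : ℝ≥0 → ℝ≥0, Continuous M ∧
        AprioriEstimate (renormalizedTerm μ) s p₁ r p₂ T U M) ∧
      (∀ r : ℝ, ¬ ∃ M : ℝ≥0 → ℝ≥0, Continuous M ∧
        SobolevAprioriEstimate (d := d) (renormalizedTerm μ) s r T M)) := by
  have hbdd {M : ℝ≥0 → ℝ≥0} (hM : Continuous M) : (𝓝 0).IsBoundedUnder (· ≤ ·) M :=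
    (hM.tendsto 0).isBoundedUnder_le
  obtain ⟨h₁, h₂⟩ := corollary1p2_general d σ μ (by rcases hμ with rfl | rfl <;> simp) p₁ p₂ s T hT
  exact ⟨fun h => ⟨fun r ⟨U, hU, M, hM, hest⟩ => (h₁ h).1 r ⟨U, hU, M, hbdd hM, hest⟩,
      fun r ⟨M, hM, hest⟩ => (h₁ h).2 r ⟨M, hbdd hM, hest⟩⟩,
    fun h => ⟨fun r ⟨U, hU, M, hM, hest⟩ => (h₂ h).1 r ⟨U, hU, M, hbdd hM, hest⟩,
      fun r ⟨M, hM, hest⟩ => (h₂ h).2 r ⟨M, hbdd hM, hest⟩⟩⟩
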